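/- Let $(X,\mathcal A,\nu)$ be a measure space and let $H$ be a real reproducing kernel Hilbert space on $X$ with measurable kernel $k$ that is compactly embedded into $L^2(\nu)$: every $f\in H$ is square integrable with respect to $\nu$, and the map $I_k\colon H\to L^2(\nu)$, $f\mapsto[f]_\sim$ (the $\nu$-a.e. equivalence class of $f$), is a compact operator (not necessarily injective). Let $T_k:=I_kI_k^*\colon L^2(\nu)\to L^2(\nu)$ be the integral operator of $k$, and equip the range $[H]_\sim$ of $I_k$ with the quotient norm $\|u\|_{[H]_\sim}:=\inf\{\|g\|_H : g\in H,\ [g]_\sim=u\}$. There are an index set $I=\{1,\dots,n\}$ with $n\ge 0$, or $I=\mathbb N$, a family $\mu=(\mu_i)_{i\in I}$ that lists the non-zero eigenvalues of $T_k$ with multiplicity in non-increasing order (they are all positive), and associated eigenfunctions $e_i\in H$, $i\in I$, meaning that $T_k[e_i]_\sim=\mu_i[e_i]_\sim$, that $([e_i]_\sim)_{i\in I}$ is orthonormal in $L^2(\nu)$, and that $(\sqrt{\mu_i}\,e_i)_{i\in I}$ is orthonormal in $H$. Let $0<\theta<1$ and $1\le r\le\infty$. For $f\in L^2(\nu)$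 and $t>0$ let $$K(f,t):=\inf_{u\in[H]_\sim}\bigl(\|f-u\|_{L^2(\nu)}+t\,\|u\|_{[H]_\sim}\bigr),$$ let $\|f\|_{[L^2(\nu),[H]_\sim]_{\theta,r}}:=\bigl(\int_0^\infty t^{-\theta r-1}K(f,t)^r\,dt\bigr)^{1/r}$ if $r<\infty$ and $\|f\|_{[L^2(\nu),[H]_\sim]_{\theta,\infty}}:=\sup_{t>0}t^{-\theta}K(f,t)$, and let $[L^2(\nu),[H]_\sim]_{\theta,r}$ be the space of all $f\in L^2(\nu)$ for which this norm is finite. For any $(\mu_i)_{i\in I}$, $(e_i)_{i\in I}$ as above put $M_j:=\{i\in I: 2^j<\mu_i^{-1}\le 2^{j+1}\}$ for $j\in\mathbb Z$. For a real family $b=(b_i)_{i\in I}$ let $c_j(b):=\bigl(\sum_{i\in M_j}b_i^2\mu_i^{-\theta}\bigr)^{1/2}$ and $\|b\|_{(\mu,\theta,r)}:=\|(c_j(b))_{j\in\mathbb Z}\|_{\ell^r(\mathbb Z)}$, and let $\ell^{(\mu,\theta,r)}$ be the set of all $b$ with $\|b\|_{(\mu,\theta,r)}<\infty$. The power space is $$H_\nu^{(\theta,r)}:=\Bigl\{f\in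 L^2(\nu) : f=\sum_{i\in I}b_i[e_i]_\sim \text{ in } L^2(\nu)\text{ for some } b\in\ell^{(\mu,\theta,r)}\Bigr\},\qquad \Bigl\|\sum_{i\in I}b_i[e_i]_\sim\Bigr\|_{H_\nu^{(\theta,r)}}:=\|b\|_{(\mu,\theta,r)}.$$ Then $H_\nu^{(\theta,r)}=[L^2(\nu),[H]_\sim]_{\theta,r}$ as sets, and the norms of these two spaces are equivalent: there are constants $c,C>0$ such that $c\,\|f\|_{H_\nu^{(\theta,r)}}\le\|f\|_{[L^2(\nu),[H]_\sim]_{\theta,r}}\le C\,\|f\|_{H_\nu^{(\theta,r)}}$ for all $f\in H_\nu^{(\theta,r)}$. -/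

import Mathlib

open MeasureTheory Set
open scoped ENNReal InnerProductSpace

noncomputable section

/-! ### The real interpolation method -/

section Interpolation

variable {E₂ : Type*} [NormedAddCommGroup E₂] [NormedSpace ℝ E₂]

/-- The `K`-functional `K(x, t, E₂, E₁) = inf_{y ∈ E₁} (‖x - y‖_{E₂} + t ‖y‖_{E₁})` of a normed
space `E₂` and a linear subspace `E₁` of `E₂` that carries its own norm `N`. -/
def KFunctional (E₁ : Submodule ℝ E₂) (N : E₁ → ℝ) (t : ℝ) (x : E₂) : ℝ :=
  ⨅ y : E₁, (‖x - (y : E₂)‖ + t * N y)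

/-- The norm of `[E₂, E₁]_{θ,r}`, with the value `∞` on vectors outside of this space. -/
def interpolationNorm (E₁ : Submodule ℝ E₂) (N : E₁ → ℝ) (θ : ℝ) (r : ℝ≥0∞) (x : E₂) : ℝ≥0∞ :=
  if r = ∞ then
    ⨆ t : Ioi (0 : ℝ), ENNReal.ofReal ((t : ℝ) ^ (-θ) * KFunctional E₁ N t x)
  else
    (∫⁻ t in Ioi (0 : ℝ),
      ENNReal.ofReal (t ^ (-θ * r.toReal - 1) * KFunctional E₁ N t x ^ r.toReal)) ^ (1 / r.toReal)

/-- The real interpolation space `[E₂, E₁]_{θ,r}`. -/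
def interpolationSpace (E₁ : Submodule ℝ E₂) (N : E₁ → ℝ) (θ : ℝ) (r : ℝ≥0∞) : Set E₂ :=
  {x | interpolationNorm E₁ N θ r x < ∞}

end Interpolation

/-! ### Reproducing kernel Hilbert spaces that are compactly embedded into `L²(ν)` -/

section Embedding

variable {X : Type*} [MeasurableSpace X]
  {H : Type*} [NormedAddCommGroup H] [InnerProductSpace ℝ H] [RKHS ℝ H X ℝ]

variable (H) in
/-- The real-valued reproducing kernel `k : X × X → ℝ` of `H`. -/
def scalarKernel [CompleteSpace H] (p : X × X) : ℝ := RKHS.kernel H p.1 p.2 1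

/-- The map `f ↦ [f]_∼` from `H` to `L²(ν)`, when all elements of `H` are square integrable. -/
def toL2 {ν : Measure X} (h : ∀ f : H, MemLp (f : X → ℝ) 2 ν) : H →ₗ[ℝ] Lp ℝ 2 ν where
  toFun f := (h f).toLp f
  map_add' f g := by
    rw [← MemLp.toLp_add]
    exact MemLp.toLp_congr _ _ (by simp)
  map_smul' c f := by
    rw [RingHom.id_apply, ← MemLp.toLp_const_smul]
    exact MemLp.toLp_congr _ _ (by simp)

variable (H) in
/-- `H` is compactly embedded into `L²(ν)`: the map `f ↦ [f]_∼` is well defined from `H` to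
`L²(ν)` and it is a compact operator. (It need not be injective.) -/
structure CompactlyEmbedded (ν : Measure X) : Prop where
  memLp : ∀ f : H, MemLp (f : X → ℝ) 2 ν
  isCompactOperator : IsCompactOperator (toL2 memLp)

namespace CompactlyEmbedded

variable {ν : Measure X} (h : CompactlyEmbedded H ν)

/-- The operator `I_k : H → L²(ν)`, `f ↦ [f]_∼`. -/
def embedding : H →L[ℝ] Lp ℝ 2 ν :=
  ContinuousLinearMap.mkOfIsCompactOperator h.isCompactOperator

/-- The linear subspace `[H]_∼` of `L²(ν)`. -/
def classes : Submodule ℝ (Lp ℝ 2 ν) := LinearMap.range (h.embedding : H →ₗ[ℝ] Lp ℝ 2 ν)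

/-- The quotient norm of `[H]_∼`, `‖u‖ = inf {‖g‖_H | I_k g = u}`. -/
def quotientNorm (u : h.classes) : ℝ :=
  ⨅ g : {g : H // h.embedding g = (u : Lp ℝ 2 ν)}, ‖(g : H)‖

/-- The integral operator `T_k = I_k I_k^*` on `L²(ν)`. -/
def integralOperator [CompleteSpace H] : Lp ℝ 2 ν →L[ℝ] Lp ℝ 2 ν :=
  h.embedding ∘L ContinuousLinearMap.adjoint h.embedding

end CompactlyEmbedded

/-- The index set `{0, 1, …, n - 1}` if `N = n` is finite, and `ℕ` if `N = ∞`. -/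
abbrev IndexSet (N : ℕ∞) : Type := {i : ℕ // (i : ℕ∞) < N}

/-- `μ` lists the non-zero eigenvalues of the integral operator in non-increasing order, repeated
according to multiplicity, and `e` lists associated eigenfunctions `e i ∈ H`, such that the classes
`[e i]_∼` are orthonormal in `L²(ν)` and the functions `√(μ i) • e i` are orthonormal in `H`. -/
structure IsEigensystem [CompleteSpace H] {ν : Measure X} (h : CompactlyEmbedded H ν) (N : ℕ∞)
    (μ : IndexSet N → ℝ) (e : IndexSet N → H) : Prop where
  antitone : Antitone μ
  ne_zero : ∀ i, μ i ≠ 0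
  orthonormal_classes : Orthonormal ℝ (fun i => h.embedding (e i))
  orthonormal : Orthonormal ℝ (fun i => √(μ i) • e i)
  /-- For each `c ≠ 0`, the `[e i]_∼` with `μ i = c` span the eigenspace of `c`. So each of them
  is an eigenvector for `μ i`, and each non-zero eigenvalue is listed as often as its
  multiplicity requires. -/
  span_eq : ∀ c : ℝ, c ≠ 0 →
    Submodule.span ℝ ((fun i => h.embedding (e i)) '' {i | μ i = c}) =
      Module.End.eigenspace (h.integralOperator : Lp ℝ 2 ν →ₗ[ℝ] Lp ℝ 2 ν) c

end Embedding

/-! ### The sequence spaces and the power spaces -/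

section Power

/-- The `ℓ^r`-norm of a family of non-negative extended real numbers, `1 ≤ r ≤ ∞`. -/
def lrNorm {J : Type*} (r : ℝ≥0∞) (c : J → ℝ≥0∞) : ℝ≥0∞ :=
  if r = ∞ then ⨆ j, c j else (∑' j, c j ^ r.toReal) ^ (1 / r.toReal)

variable {I : Type*}

/-- The dyadic block `M_j` of the weight `w = μ⁻¹`: all `i` with `2 ^ j < μ_i⁻¹ ≤ 2 ^ (j + 1)`. -/
def dyadicBlock (μ : I → ℝ) (j : ℤ) : Set I :=
  {i | (2 : ℝ) ^ j < (μ i)⁻¹ ∧ (μ i)⁻¹ ≤ (2 : ℝ) ^ (j + 1)}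

/-- `c_j(b) = (∑_{i ∈ M_j} b_i² μ_i^{-θ})^{1/2}`. -/
def blockNorm (μ : I → ℝ) (θ : ℝ) (b : I → ℝ) (j : ℤ) : ℝ≥0∞ :=
  (∑' i : dyadicBlock μ j, ENNReal.ofReal (b i ^ 2 * μ i ^ (-θ))) ^ (1 / 2 : ℝ)

/-- The norm `‖b‖_{(μ,θ,r)} = ‖(c_j(b))_{j ∈ ℤ}‖_{ℓ^r}`, with values in `[0, ∞]`. -/
def sequenceNorm (μ : I → ℝ) (θ : ℝ) (r : ℝ≥0∞) (b : I → ℝ) : ℝ≥0∞ :=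
  lrNorm r (blockNorm μ θ b)

/-- The sequence space `ℓ^{(μ,θ,r)}`. -/
def sequenceSpace (μ : I → ℝ) (θ : ℝ) (r : ℝ≥0∞) : Set (I → ℝ) :=
  {b | sequenceNorm μ θ r b < ∞}

variable {E : Type*} [NormedAddCommGroup E] [InnerProductSpace ℝ E]

/-- The power space: all `f = ∑ b_i u_i` (converging in `E`) with `b ∈ ℓ^{(μ,θ,r)}`. It is used for
`E = L²(ν)` and `u_i = [e_i]_∼`. -/
def powerSpace (μ : I → ℝ) (u : I → E) (θ : ℝ) (r : ℝ≥0∞) : Set E :=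
  {f | ∃ b ∈ sequenceSpace μ θ r, HasSum (fun i => b i • u i) f}

/-- The norm of the power space, `‖∑ b_i u_i‖ = ‖b‖_{(μ,θ,r)}`. When `u` is orthonormal, the infimum
runs over at most one sequence `b`, see `powerNorm_eq`. -/
def powerNorm (μ : I → ℝ) (u : I → E) (θ : ℝ) (r : ℝ≥0∞) (f : E) : ℝ≥0∞ :=
  ⨅ (b : I → ℝ) (_ : HasSum (fun i => b i • u i) f), sequenceNorm μ θ r b

theorem powerNorm_eq (μ : I → ℝ) {u : I → E} (hu : Orthonormal ℝ u) (θ : ℝ) (r : ℝ≥0∞)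
    {b : I → ℝ} {f : E} (hb : HasSum (fun i => b i • u i) f) :
    powerNorm μ u θ r f = sequenceNorm μ θ r b := by
  classical
  have key : ∀ b' : I → ℝ, HasSum (fun i => b' i • u i) f → ∀ i, b' i = ⟪u i, f⟫_ℝ := by
    intro b' h i
    have h1 := h.mapL (innerSL ℝ (u i))
    have h2 : (fun j => innerSL ℝ (u i) (b' j • u j)) = fun j => if j = i then b' i else 0 := by
      funext j
      rw [innerSL_apply_apply, inner_smul_right, orthonormal_iff_ite.mp hu i j]
      by_cases hij : j = i
      · subst hij; simp
      · simp [hij, Ne.symm hij]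
    rw [h2] at h1
    exact (hasSum_ite_eq i (b' i)).unique h1
  refine le_antisymm (iInf₂_le b hb) (le_iInf₂ fun b' hb' => ?_)
  have : b' = b := funext fun i => (key b' hb' i).trans (key b hb i).symm
  rw [this]

end Power

end

/-! Write `S` for the embedding `I_k`. In the orthonormal systems `√(μ i) • e i` of `H` and `S (e
i)` of `L²(ν)` it is diagonal with entries `√(μ i)`, so the K-functional decouples. For `f = ∑ b_i S
e_i` it costs least, up to a factor 2, to put coefficient `i` into `u` when `t² < μ_i` and to leave
it in the residual otherwise. Hence `K(f,t)` is comparable to `(∑ min(1, t²/μ_i) b_i²)^{1/2}`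
(`truncNorm_le`, `exists_le_truncNorm`).

Since `K(f,·)` is monotone, the interpolation norm is comparable to the `ℓ^r`-norm of the samples of
`t^{-θ} K(f,t)` at `t = 2^{-k/2}` (`lrNorm_dyadicSample_le`, `dilationNorm_le`). The block `M_k`
alone bounds the sample at scale `k` from below. From above, `M_j` contributes at most a multiple of
`2^{-min(θ,1-θ)|j-k|/2} c_j(b)`. This is a convolution with a summable kernel, and Young's
inequality `lrNorm_conv_le` closes the estimate.

For equality of the sets, a finite interpolation norm forces `K(f,t) → 0` along `t → 0`, so `f` lies
in the closure of the range of `S`. There the `S (e i)` are complete, by the spectral theorem for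
the compact symmetric operator `S S^*`, which also yields the eigensystem. -/

noncomputable section

/-! ### `ℓ^r`-norms -/

section LrNorm

variable {J J' : Type*} {r : ℝ≥0∞}

theorem one_le_toReal_of_one_le (hr : 1 ≤ r) (h : r ≠ ∞) : 1 ≤ r.toReal := by
  simpa using ENNReal.toReal_mono h hr

theorem lrNorm_mono {c d : J → ℝ≥0∞} (h : ∀ j, c j ≤ d j) : lrNorm r c ≤ lrNorm r d := by
  unfold lrNorm
  split_ifs
  · exact iSup_mono h
  · gcongr with j
    exact h j

theorem lrNorm_const_mul (hr : 1 ≤ r) (a : ℝ≥0∞) (c : J → ℝ≥0∞) :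
    lrNorm r (fun j => a * c j) = a * lrNorm r c := by
  unfold lrNorm
  split_ifs with h
  · rw [ENNReal.mul_iSup]
  · have hp := one_le_toReal_of_one_le hr h
    have hp0 : 0 ≤ r.toReal := by linarith
    simp_rw [ENNReal.mul_rpow_of_nonneg _ _ hp0]
    rw [ENNReal.tsum_mul_left, ENNReal.mul_rpow_of_nonneg _ _ (by positivity), ← ENNReal.rpow_mul,
      mul_one_div_cancel (by linarith), ENNReal.rpow_one]

theorem lrNorm_comp_equiv (σ : J' ≃ J) (c : J → ℝ≥0∞) :
    lrNorm r (fun j => c (σ j)) = lrNorm r c := by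
  unfold lrNorm
  split_ifs
  · exact σ.iSup_comp (g := c)
  · rw [σ.tsum_eq (fun j => c j ^ r.toReal)]

theorem le_lrNorm (hr : 1 ≤ r) (c : J → ℝ≥0∞) (j : J) : c j ≤ lrNorm r c := by
  unfold lrNorm
  split_ifs with h
  · exact le_iSup c j
  · have hp := one_le_toReal_of_one_le hr h
    calc c j = (c j ^ r.toReal) ^ (1 / r.toReal) := by
          rw [← ENNReal.rpow_mul, mul_one_div_cancel (by linarith), ENNReal.rpow_one]
      _ ≤ _ := by
          gcongr
          exact ENNReal.le_tsum (f := fun j => c j ^ r.toReal) j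

theorem tsum_mul_le_weight_mul_Lp {p : ℝ} (hp : 1 ≤ p) (w f : J → ℝ≥0∞) :
    ∑' j, w j * f j ≤ (∑' j, w j) ^ (1 - p⁻¹) * (∑' j, w j * f j ^ p) ^ p⁻¹ := by
  have hp1 : 0 ≤ 1 - p⁻¹ := sub_nonneg.2 (inv_le_one_of_one_le₀ hp)
  rw [ENNReal.tsum_eq_iSup_sum]
  refine iSup_le fun s => (ENNReal.inner_le_weight_mul_Lp_of_nonneg s hp w f).trans ?_
  gcongr
  · exact ENNReal.sum_le_tsum s
  · exact ENNReal.sum_le_tsum (f := fun j => w j * f j ^ p) s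

/-- **Young's inequality** for the convolution of an `ℓ^1`-sequence with an `ℓ^r`-sequence. -/
theorem lrNorm_conv_le (hr : 1 ≤ r) (w c : ℤ → ℝ≥0∞) :
    lrNorm r (fun k => ∑' j, w (j - k) * c j) ≤ (∑' n, w n) * lrNorm r c := by
  have shift : ∀ k, ∑' j, w (j - k) = ∑' n, w n := fun k =>
    (Equiv.subRight k).tsum_eq w
  by_cases h : r = ∞
  · simp only [lrNorm, h, if_true]
    refine iSup_le fun k => ?_
    rw [← shift k, ← ENNReal.tsum_mul_right]
    exact ENNReal.tsum_le_tsum fun j => mul_le_mul_right (le_iSup c j) _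
  · simp only [lrNorm, h, if_false]
    set p := r.toReal with hpdef
    have hp : 1 ≤ p := one_le_toReal_of_one_le hr h
    have hp0 : 0 ≤ p := by linarith
    set W := ∑' n, w n with hW
    have shift' : ∀ j, ∑' k, w (j - k) = W := fun j =>
      (Equiv.subLeft j).tsum_eq w
    -- Hölder with respect to the weights `w (j - k)`, whose total mass `W` does not depend on `k`.
    -- Summing over `k` and exchanging the sums produces the remaining factor `W`.
    have e1 : ∀ k, (∑' j, w (j - k) * c j) ^ p ≤
        W ^ (p - 1) * ∑' j, w (j - k) * c j ^ p := by
      intro k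
      calc (∑' j, w (j - k) * c j) ^ p
          ≤ (W ^ (1 - p⁻¹) * (∑' j, w (j - k) * c j ^ p) ^ p⁻¹) ^ p := by
            gcongr
            rw [← shift k]
            exact tsum_mul_le_weight_mul_Lp hp (fun j => w (j - k)) c
        _ = _ := by
            rw [ENNReal.mul_rpow_of_nonneg _ _ hp0, ← ENNReal.rpow_mul, ← ENNReal.rpow_mul,
              inv_mul_cancel₀ (by linarith), ENNReal.rpow_one, sub_mul, one_mul,
              inv_mul_cancel₀ (by linarith)]
    have e2 : ∑' k, (∑' j, w (j - k) * c j) ^ p ≤ W ^ p * ∑' j, c j ^ p := by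
      calc ∑' k, (∑' j, w (j - k) * c j) ^ p
          ≤ ∑' k, W ^ (p - 1) * ∑' j, w (j - k) * c j ^ p := ENNReal.tsum_le_tsum e1
        _ = W ^ (p - 1) * (W * ∑' j, c j ^ p) := by
            rw [ENNReal.tsum_mul_left, ENNReal.tsum_comm, ← ENNReal.tsum_mul_left (a := W)]
            congr 2
            funext j
            rw [ENNReal.tsum_mul_right, shift']
        _ = W ^ p * ∑' j, c j ^ p := by
            rw [← mul_assoc]
            congr 1
            nth_rw 2 [← ENNReal.rpow_one W]
            rw [← ENNReal.rpow_add_of_nonneg _ _ (by linarith) zero_le_one, sub_add_cancel]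
    calc (∑' k, (∑' j, w (j - k) * c j) ^ p) ^ (1 / p)
        ≤ (W ^ p * ∑' j, c j ^ p) ^ (1 / p) := by gcongr
      _ = _ := by
        rw [ENNReal.mul_rpow_of_nonneg _ _ (by positivity), ← ENNReal.rpow_mul,
          mul_one_div_cancel (by linarith), ENNReal.rpow_one]

end LrNorm

/-! ### Discretization of the interpolation norm -/

section Discretization

/-- The dyadic scale `2^{-k/2}`. -/
def halfScale (k : ℤ) : ℝ := 2 ^ (-(k : ℝ) / 2)

theorem halfScale_pos (k : ℤ) : 0 < halfScale k := by unfold halfScale; positivity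

/-- The reason for the half in the exponent: the truncation depends on `t² / μ_i`, so `t = 2^{-k/2}`
compares `μ_i⁻¹` with `2^k`, the lower end of `M_k`. -/
theorem halfScale_sq (k : ℤ) : halfScale k ^ 2 = ((2 : ℝ) ^ k)⁻¹ := by
  unfold halfScale
  rw [← Real.rpow_natCast, ← Real.rpow_mul (by norm_num), ← Real.rpow_intCast,
    ← Real.rpow_neg (by norm_num)]
  congr 1
  push_cast; ring

theorem halfScale_sub_one (k : ℤ) : halfScale (k - 1) = √2 * halfScale k := by
  unfold halfScale
  rw [Real.sqrt_eq_rpow, ← Real.rpow_add (by norm_num)]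
  congr 1
  push_cast; ring

theorem halfScale_antitone : Antitone halfScale := by
  intro a b hab
  unfold halfScale
  have : (a : ℝ) ≤ b := by exact_mod_cast hab
  exact Real.rpow_le_rpow_of_exponent_le (by norm_num) (by linarith)

theorem iUnion_Ico_halfScale : ⋃ k : ℤ, Ico (halfScale k) (halfScale (k - 1)) = Ioi 0 := by
  ext t
  simp only [mem_iUnion, mem_Ioi]
  constructor
  · rintro ⟨k, hk⟩
    exact (halfScale_pos k).trans_le hk.1
  · intro ht
    have h2 : (1 : ℝ) < √2 := by
      rw [Real.lt_sqrt (by norm_num)]; norm_num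
    obtain ⟨n, hn⟩ := exists_mem_Ico_zpow ht h2
    have key : ∀ n : ℤ, √2 ^ n = halfScale (-n) := by
      intro n
      unfold halfScale
      rw [Real.sqrt_eq_rpow, ← Real.rpow_mul_intCast (by norm_num)]
      congr 1
      push_cast; ring
    refine ⟨-n, ?_⟩
    rw [key, key] at hn
    rwa [show -n - 1 = -(n + 1) by ring]

theorem pairwise_disjoint_Ico_halfScale :
    Pairwise (Function.onFun Disjoint fun k : ℤ => Ico (halfScale k) (halfScale (k - 1))) := by
  intro a b hab
  wlog h : a < b generalizing a b
  · exact (this hab.symm (lt_of_le_of_ne (not_lt.1 h) hab.symm)).symm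
  refine Set.disjoint_left.2 fun t ha hb => ?_
  have := halfScale_antitone (show a ≤ b - 1 by omega)
  exact absurd (hb.2.trans_le this) (not_lt.2 ha.1)

theorem sqrt_two_bounds : 4 / 3 < √2 ∧ √2 < 3 / 2 := by
  constructor
  · rw [Real.lt_sqrt (by norm_num)]; norm_num
  · rw [Real.sqrt_lt' (by norm_num)]; norm_num

/-- Every shell has the same mass `log √2` under the scale-invariant measure `dt/t`. The bounds 1
here and 1/4 below come from the endpoint values of `1/t`. -/
theorem lintegral_inv_Ico_halfScale_le (k : ℤ) :
    ∫⁻ t in Ico (halfScale k) (halfScale (k - 1)), ENNReal.ofReal t⁻¹ ≤ 1 := by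
  have hs := halfScale_pos k
  calc ∫⁻ t in Ico (halfScale k) (halfScale (k - 1)), ENNReal.ofReal t⁻¹
      ≤ ∫⁻ t in Ico (halfScale k) (halfScale (k - 1)), ENNReal.ofReal (halfScale k)⁻¹ := by
        refine setLIntegral_mono' measurableSet_Ico fun t ht => ?_
        exact ENNReal.ofReal_le_ofReal (inv_anti₀ hs ht.1)
    _ ≤ 1 := by
        rw [setLIntegral_const, Real.volume_Ico, ← ENNReal.ofReal_mul (by positivity),
          ← ENNReal.ofReal_one]
        refine ENNReal.ofReal_le_ofReal ?_
        rw [halfScale_sub_one, inv_mul_le_iff₀ hs]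
        nlinarith [sqrt_two_bounds.2]

theorem one_le_lintegral_inv_Ico_halfScale (k : ℤ) :
    1 ≤ 4 * ∫⁻ t in Ico (halfScale k) (halfScale (k - 1)), ENNReal.ofReal t⁻¹ := by
  have hs := halfScale_pos k
  have hs' := halfScale_pos (k - 1)
  calc (1 : ℝ≥0∞) ≤ 4 * ∫⁻ t in Ico (halfScale k) (halfScale (k - 1)),
        ENNReal.ofReal (halfScale (k - 1))⁻¹ := by
        rw [setLIntegral_const, Real.volume_Ico, ← ENNReal.ofReal_mul (by positivity),
          ← ENNReal.ofReal_one, show (4 : ℝ≥0∞) = ENNReal.ofReal 4 by norm_num,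
          ← ENNReal.ofReal_mul (by norm_num)]
        refine ENNReal.ofReal_le_ofReal ?_
        rw [mul_left_comm, ← div_eq_inv_mul, le_div_iff₀ hs', halfScale_sub_one]
        nlinarith [sqrt_two_bounds.1]
    _ ≤ _ := by
        gcongr 4 * ?_
        refine setLIntegral_mono' measurableSet_Ico fun t ht => ?_
        exact ENNReal.ofReal_le_ofReal (inv_anti₀ (hs.trans_le ht.1) ht.2.le)

variable {θ : ℝ} {Φ : ℝ → ℝ}

theorem sqrt_two_rpow_le (hθ₀ : 0 < θ) (hθ₁ : θ < 1) : √2 ^ θ ≤ 2 := by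
  calc √2 ^ θ ≤ √2 ^ (1 : ℝ) :=
        Real.rpow_le_rpow_of_exponent_le (by linarith [sqrt_two_bounds.1]) hθ₁.le
    _ ≤ 2 := by rw [Real.rpow_one]; linarith [sqrt_two_bounds.2]

theorem halfScale_rpow_le (hθ₀ : 0 < θ) (hθ₁ : θ < 1) (k : ℤ) :
    halfScale k ^ (-θ) ≤ 2 * halfScale (k - 1) ^ (-θ) := by
  have hs := halfScale_pos k
  have h2 := sqrt_two_rpow_le hθ₀ hθ₁
  have h3 : 0 < √2 ^ θ := by positivity
  rw [halfScale_sub_one, Real.mul_rpow (by positivity) hs.le, ← mul_assoc,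
    Real.rpow_neg (Real.sqrt_nonneg 2)]
  refine le_mul_of_one_le_left (by positivity) ?_
  rw [← div_eq_mul_inv, one_le_div h3]
  exact h2

/-- The integral (or supremum) that defines the norm of a real interpolation space. -/
def dilationNorm (θ : ℝ) (r : ℝ≥0∞) (Φ : ℝ → ℝ) : ℝ≥0∞ :=
  if r = ∞ then ⨆ t : Ioi (0 : ℝ), ENNReal.ofReal ((t : ℝ) ^ (-θ) * Φ t)
  else (∫⁻ t in Ioi (0 : ℝ),
      ENNReal.ofReal (t ^ (-θ * r.toReal - 1) * Φ t ^ r.toReal)) ^ (1 / r.toReal)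

/-- The samples of `t ↦ t^{-θ} Φ(t)` at the points `2^{-k/2}`. -/
def dyadicSample (θ : ℝ) (Φ : ℝ → ℝ) (k : ℤ) : ℝ≥0∞ :=
  ENNReal.ofReal (halfScale k ^ (-θ) * Φ (halfScale k))

/-- On a shell `Φ` is smallest at the left end, while `t^{-θ}` changes by a factor of at most `√2^θ
≤ 2`. The reverse bound `le_dyadicSample` uses the right end, which is the sample with index `k -
1`. -/
theorem dyadicSample_le (hθ₀ : 0 < θ) (hθ₁ : θ < 1) (hΦ : MonotoneOn Φ (Ioi 0))
    (hΦ0 : ∀ t, 0 < t → 0 ≤ Φ t) {k : ℤ} {t : ℝ}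
    (ht : t ∈ Ico (halfScale k) (halfScale (k - 1))) :
    dyadicSample θ Φ k ≤ 2 * ENNReal.ofReal (t ^ (-θ) * Φ t) := by
  have hs := halfScale_pos k
  have ht0 : 0 < t := hs.trans_le ht.1
  rw [dyadicSample, show (2 : ℝ≥0∞) = ENNReal.ofReal 2 by norm_num,
    ← ENNReal.ofReal_mul (by norm_num)]
  refine ENNReal.ofReal_le_ofReal ?_
  calc halfScale k ^ (-θ) * Φ (halfScale k)
      ≤ (2 * halfScale (k - 1) ^ (-θ)) * Φ t :=
        mul_le_mul (halfScale_rpow_le hθ₀ hθ₁ k) (hΦ hs ht0 ht.1) (hΦ0 _ hs)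
          (by have := halfScale_pos (k - 1); positivity)
    _ ≤ (2 * t ^ (-θ)) * Φ t := by
        have := Real.rpow_le_rpow_of_nonpos ht0 ht.2.le (show -θ ≤ 0 by linarith)
        have := hΦ0 t ht0
        gcongr
    _ = _ := by ring

theorem le_dyadicSample (hθ₀ : 0 < θ) (hθ₁ : θ < 1) (hΦ : MonotoneOn Φ (Ioi 0))
    (hΦ0 : ∀ t, 0 < t → 0 ≤ Φ t) {k : ℤ} {t : ℝ}
    (ht : t ∈ Ico (halfScale k) (halfScale (k - 1))) :
    ENNReal.ofReal (t ^ (-θ) * Φ t) ≤ 2 * dyadicSample θ Φ (k - 1) := by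
  have hs := halfScale_pos k
  have hs' := halfScale_pos (k - 1)
  have ht0 : 0 < t := hs.trans_le ht.1
  rw [dyadicSample, show (2 : ℝ≥0∞) = ENNReal.ofReal 2 by norm_num,
    ← ENNReal.ofReal_mul (by norm_num)]
  refine ENNReal.ofReal_le_ofReal ?_
  calc t ^ (-θ) * Φ t ≤ halfScale k ^ (-θ) * Φ (halfScale (k - 1)) :=
        mul_le_mul (Real.rpow_le_rpow_of_nonpos hs ht.1 (by linarith)) (hΦ ht0 hs' ht.2.le)
          (hΦ0 _ ht0) (by positivity)
    _ ≤ (2 * halfScale (k - 1) ^ (-θ)) * Φ (halfScale (k - 1)) := by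
        have := hΦ0 _ hs'
        gcongr
        exact halfScale_rpow_le hθ₀ hθ₁ k
    _ = _ := by ring

/-- Splits off the density of `dt/t`, leaving the `p`-th power of the quantity that is compared with
the samples. -/
theorem ofReal_rpow_mul_rpow {p t x : ℝ} (hp : 0 ≤ p) (ht : 0 < t) (hx : 0 ≤ x) :
    ENNReal.ofReal (t ^ (-θ * p - 1) * x ^ p) =
      ENNReal.ofReal t⁻¹ * ENNReal.ofReal (t ^ (-θ) * x) ^ p := by
  rw [ENNReal.ofReal_rpow_of_nonneg (by positivity) hp, ← ENNReal.ofReal_mul (by positivity),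
    Real.mul_rpow (by positivity) hx, ← Real.rpow_mul ht.le, Real.rpow_sub ht, Real.rpow_one]
  congr 1
  ring

theorem lrNorm_dyadicSample_le (hθ₀ : 0 < θ) (hθ₁ : θ < 1) (hΦ : MonotoneOn Φ (Ioi 0))
    (hΦ0 : ∀ t, 0 < t → 0 ≤ Φ t) {r : ℝ≥0∞} (hr : 1 ≤ r) :
    lrNorm r (dyadicSample θ Φ) ≤ 8 * dilationNorm θ r Φ := by
  by_cases h : r = ∞
  · simp only [lrNorm, dilationNorm, h, if_true]
    refine iSup_le fun k => ?_
    refine (le_iSup (fun t : Ioi (0 : ℝ) => ENNReal.ofReal ((t : ℝ) ^ (-θ) * Φ t))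
      ⟨halfScale k, halfScale_pos k⟩).trans ?_
    exact le_mul_of_one_le_left (zero_le) (by norm_num)
  · simp only [lrNorm, dilationNorm, h, if_false]
    set p := r.toReal with hpdef
    have hp : 1 ≤ p := one_le_toReal_of_one_le hr h
    have hp0 : 0 ≤ p := by linarith
    have key : ∀ k, dyadicSample θ Φ k ^ p ≤ 8 ^ p *
        ∫⁻ t in Ico (halfScale k) (halfScale (k - 1)),
          ENNReal.ofReal (t ^ (-θ * p - 1) * Φ t ^ p) := by
      intro k
      set D := dyadicSample θ Φ k with hD
      set B := Ico (halfScale k) (halfScale (k - 1)) with hB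
      calc D ^ p ≤ D ^ p * (4 * ∫⁻ t in B, ENNReal.ofReal t⁻¹) :=
            le_mul_of_one_le_right (zero_le) (one_le_lintegral_inv_Ico_halfScale k)
        _ = 4 * ∫⁻ t in B, ENNReal.ofReal t⁻¹ * D ^ p := by
            rw [lintegral_mul_const _ (by fun_prop)]
            ring
        _ ≤ 4 * ∫⁻ t in B, 2 ^ p * ENNReal.ofReal (t ^ (-θ * p - 1) * Φ t ^ p) := by
            gcongr 4 * ?_
            refine setLIntegral_mono' measurableSet_Ico fun t ht => ?_
            have ht0 : 0 < t := (halfScale_pos k).trans_le ht.1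
            rw [ofReal_rpow_mul_rpow hp0 ht0 (hΦ0 t ht0), mul_left_comm,
              ← ENNReal.mul_rpow_of_nonneg _ _ hp0]
            gcongr
            exact dyadicSample_le hθ₀ hθ₁ hΦ hΦ0 ht
        _ = 4 * 2 ^ p * ∫⁻ t in B, ENNReal.ofReal (t ^ (-θ * p - 1) * Φ t ^ p) := by
            -- The finite constant leaves the integral without any measurability of `Φ`.
            rw [lintegral_const_mul' _ _ (by finiteness), mul_assoc]
        _ ≤ _ := by
            gcongr
            -- The 8 is 4 (shell mass) times 2 (sampling); `4 ≤ 4 ^ p` because `p ≥ 1`.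
            calc (4 : ℝ≥0∞) * 2 ^ p = 4 ^ (1 : ℝ) * 2 ^ p := by rw [ENNReal.rpow_one]
              _ ≤ 4 ^ p * 2 ^ p := by
                gcongr
                norm_num
              _ = 8 ^ p := by
                rw [← ENNReal.mul_rpow_of_nonneg _ _ hp0]
                norm_num
    calc (∑' k, dyadicSample θ Φ k ^ p) ^ (1 / p)
        ≤ (∑' k, 8 ^ p * ∫⁻ t in Ico (halfScale k) (halfScale (k - 1)),
          ENNReal.ofReal (t ^ (-θ * p - 1) * Φ t ^ p)) ^ (1 / p) := by
            gcongr with k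
            exact key k
      _ = _ := by
        rw [ENNReal.tsum_mul_left, ENNReal.mul_rpow_of_nonneg _ _ (by positivity),
          ← ENNReal.rpow_mul, mul_one_div_cancel (by linarith), ENNReal.rpow_one,
          ← lintegral_iUnion (fun _ => measurableSet_Ico) pairwise_disjoint_Ico_halfScale,
          iUnion_Ico_halfScale]

theorem dilationNorm_le (hθ₀ : 0 < θ) (hθ₁ : θ < 1) (hΦ : MonotoneOn Φ (Ioi 0))
    (hΦ0 : ∀ t, 0 < t → 0 ≤ Φ t) {r : ℝ≥0∞} (hr : 1 ≤ r) :
    dilationNorm θ r Φ ≤ 2 * lrNorm r (dyadicSample θ Φ) := by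
  by_cases h : r = ∞
  · simp only [lrNorm, dilationNorm, h, if_true]
    refine iSup_le fun ⟨t, ht⟩ => ?_
    rw [← iUnion_Ico_halfScale] at ht
    obtain ⟨k, hk⟩ := mem_iUnion.1 ht
    refine (le_dyadicSample hθ₀ hθ₁ hΦ hΦ0 hk).trans ?_
    gcongr
    exact le_iSup (dyadicSample θ Φ) _
  -- Shell `k` is controlled by sample `k - 1`, and the `ℓ^r`-norm is invariant under this shift.
  · rw [← lrNorm_const_mul hr, ← lrNorm_comp_equiv (Equiv.subRight (1 : ℤ))]
    simp only [lrNorm, dilationNorm, h, if_false, Equiv.subRight_apply]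
    set p := r.toReal with hpdef
    have hp : 1 ≤ p := one_le_toReal_of_one_le hr h
    have hp0 : 0 ≤ p := by linarith
    rw [← iUnion_Ico_halfScale,
      lintegral_iUnion (fun _ => measurableSet_Ico) pairwise_disjoint_Ico_halfScale]
    gcongr with k
    set D := 2 * dyadicSample θ Φ (k - 1) with hD
    calc ∫⁻ t in Ico (halfScale k) (halfScale (k - 1)),
          ENNReal.ofReal (t ^ (-θ * p - 1) * Φ t ^ p)
        ≤ ∫⁻ t in Ico (halfScale k) (halfScale (k - 1)), ENNReal.ofReal t⁻¹ * D ^ p := by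
          refine setLIntegral_mono' measurableSet_Ico fun t ht => ?_
          have ht0 : 0 < t := (halfScale_pos k).trans_le ht.1
          rw [ofReal_rpow_mul_rpow hp0 ht0 (hΦ0 t ht0)]
          gcongr
          exact le_dyadicSample hθ₀ hθ₁ hΦ hΦ0 ht
      _ ≤ 1 * D ^ p := by
          rw [lintegral_mul_const _ (by fun_prop)]
          gcongr
          exact lintegral_inv_Ico_halfScale_le k
      _ = D ^ p := one_mul _

end Discretization

/-! ### Truncated norms and dyadic blocks -/

section Truncation

variable {I : Type*} {μ : I → ℝ} {θ : ℝ}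

/-- `(∑ min(1, t² / μ_i) b_i²)^{1/2}`. -/
def truncNorm (μ b : I → ℝ) (t : ℝ) : ℝ≥0∞ :=
  (∑' i, ENNReal.ofReal (min 1 (t ^ 2 / μ i) * b i ^ 2)) ^ (1 / 2 : ℝ)

theorem ENNReal.mul_rpow_half_sq (a x : ℝ≥0∞) : (a ^ 2 * x) ^ (1 / 2 : ℝ) = a * x ^ (1 / 2 : ℝ) := by
  rw [ENNReal.mul_rpow_of_nonneg _ _ (by norm_num), ← ENNReal.rpow_natCast, ← ENNReal.rpow_mul]
  norm_num

/-- With `S` the right-hand side, `x_j^{1/2} ≤ S` gives `x_j ≤ S x_j^{1/2}`; sum over `j`. -/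
theorem ENNReal.tsum_rpow_half_le {J : Type*} (x : J → ℝ≥0∞) :
    (∑' j, x j) ^ (1 / 2 : ℝ) ≤ ∑' j, x j ^ (1 / 2 : ℝ) := by
  set S := ∑' j, x j ^ (1 / 2 : ℝ) with hS
  have h : ∑' j, x j ≤ S ^ 2 * 1 := by
    rw [mul_one, sq]
    nth_rw 1 [hS]
    rw [← ENNReal.tsum_mul_right]
    refine ENNReal.tsum_le_tsum fun j => ?_
    calc x j = x j ^ (1 / 2 : ℝ) * x j ^ (1 / 2 : ℝ) := by
          rw [← ENNReal.rpow_add_of_nonneg _ _ (by norm_num) (by norm_num)]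
          norm_num
      _ ≤ _ := by
          gcongr
          exact ENNReal.le_tsum (f := fun j => x j ^ (1 / 2 : ℝ)) j
  calc (∑' j, x j) ^ (1 / 2 : ℝ) ≤ (S ^ 2 * 1) ^ (1 / 2 : ℝ) := by gcongr
    _ = S := by rw [ENNReal.mul_rpow_half_sq]; simp

theorem halfScale_rpow_neg_sq (θ : ℝ) (k : ℤ) : (halfScale k ^ (-θ)) ^ 2 = ((2 : ℝ) ^ k) ^ θ := by
  have hs := halfScale_pos k
  rw [← Real.rpow_natCast, ← Real.rpow_mul hs.le, mul_comm, Real.rpow_mul hs.le, Real.rpow_natCast,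
    halfScale_sq, Real.rpow_neg (by positivity), Real.inv_rpow (by positivity), inv_inv]

theorem two_zpow_succ_rpow_le (hθ₁ : θ < 1) (k : ℤ) :
    ((2 : ℝ) ^ (k + 1)) ^ θ ≤ 2 * ((2 : ℝ) ^ k) ^ θ := by
  rw [zpow_add₀ (by norm_num), zpow_one, Real.mul_rpow (by positivity) (by norm_num), mul_comm]
  gcongr
  calc (2 : ℝ) ^ θ ≤ 2 ^ (1 : ℝ) := Real.rpow_le_rpow_of_exponent_le (by norm_num) hθ₁.le
    _ = 2 := Real.rpow_one 2

/-- Only the terms with `i ∈ M_k` are kept. There the minimum equals 1 at `t = 2^{-k/2}`, and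
`μ_i^{-θ} ≤ 2 · 2^{kθ}`. -/
theorem blockNorm_le_truncNorm (hμ : ∀ i, 0 < μ i) (hθ₀ : 0 < θ) (hθ₁ : θ < 1) (b : I → ℝ)
    (k : ℤ) :
    blockNorm μ θ b k ≤
      2 * (ENNReal.ofReal (halfScale k ^ (-θ)) * truncNorm μ b (halfScale k)) := by
  have hs := halfScale_pos k
  set A := halfScale k ^ (-θ) with hA
  have hA0 : 0 ≤ A := by positivity
  have hA2 : A ^ 2 = ((2 : ℝ) ^ k) ^ θ := halfScale_rpow_neg_sq θ k
  rw [← mul_assoc, truncNorm, ← ENNReal.mul_rpow_half_sq, ← ENNReal.tsum_mul_left, blockNorm]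
  gcongr ?_ ^ (1 / 2 : ℝ)
  refine le_trans (ENNReal.tsum_le_tsum fun i : dyadicBlock μ k => ?_)
    (ENNReal.tsum_comp_le_tsum_of_injective Subtype.val_injective
      (fun i => (2 * ENNReal.ofReal A) ^ 2 *
        ENNReal.ofReal (min 1 (halfScale k ^ 2 / μ i) * b i ^ 2)))
  obtain ⟨i, h1, h2⟩ := i
  have hi := hμ i
  simp only
  rw [show (2 : ℝ≥0∞) = ENNReal.ofReal 2 by norm_num, ← ENNReal.ofReal_mul (by norm_num),
    ← ENNReal.ofReal_pow (by positivity), ← ENNReal.ofReal_mul (by positivity)]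
  refine ENNReal.ofReal_le_ofReal ?_
  have hm : min 1 (halfScale k ^ 2 / μ i) = 1 := by
    refine min_eq_left ?_
    rw [halfScale_sq, div_eq_mul_inv, ← div_eq_inv_mul, one_le_div (by positivity)]
    exact h1.le
  have hw : μ i ^ (-θ) ≤ 2 * ((2 : ℝ) ^ k) ^ θ := by
    rw [Real.rpow_neg hi.le, ← Real.inv_rpow hi.le]
    exact (Real.rpow_le_rpow (by positivity) h2 hθ₀.le).trans (two_zpow_succ_rpow_le hθ₁ k)
  rw [hm, one_mul, mul_pow, hA2, mul_comm]
  have : 0 ≤ ((2 : ℝ) ^ k) ^ θ := by positivity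
  gcongr
  linarith

/-- The decay rate of the interaction of the dyadic scale `j` with the dyadic scale `k`. -/
def blockDecay (θ : ℝ) : ℝ := 2 ^ (-(min θ (1 - θ)) / 2)

/-- The weights that bound the interaction of the dyadic scales. -/
def blockWeight (θ : ℝ) (n : ℤ) : ℝ≥0∞ := ENNReal.ofReal (blockDecay θ ^ n.natAbs)

theorem blockDecay_pos : 0 < blockDecay θ := by unfold blockDecay; positivity

/-- A two-sided geometric series, whose ratio is below 1 because `θ` and `1 - θ` are both positive.
-/
theorem tsum_blockWeight_lt_top (hθ₀ : 0 < θ) (hθ₁ : θ < 1) : ∑' n, blockWeight θ n < ∞ := by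
  have h1 : blockDecay θ < 1 := by
    refine Real.rpow_lt_one_of_one_lt_of_neg (by norm_num) ?_
    have : 0 < min θ (1 - θ) := lt_min hθ₀ (by linarith)
    linarith
  have hg := summable_geometric_of_lt_one (blockDecay_pos (θ := θ)).le h1
  have hs : Summable fun n : ℤ => blockDecay θ ^ n.natAbs := by
    refine Summable.of_nat_of_neg ?_ ?_ <;> simpa using hg
  exact hs.tsum_ofReal_lt_top

theorem blockDecay_sq_pow (n : ℕ) :
    (blockDecay θ ^ n) ^ 2 = ((2 : ℝ) ^ (n : ℤ)) ^ (-(min θ (1 - θ))) := by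
  rw [blockDecay, ← Real.rpow_natCast, ← Real.rpow_natCast, ← Real.rpow_mul (by positivity),
    ← Real.rpow_mul (by norm_num), ← Real.rpow_intCast, ← Real.rpow_mul (by norm_num)]
  congr 1
  push_cast; ring

/-- `min(1,y) y^{-θ}` equals `y^{-θ}` for `y ≥ 1` and `y^{1-θ}` for `y ≤ 1`, so it decays
geometrically in both directions of `n`. The 4 absorbs the width of the block and has the convenient
square root 2. -/
theorem min_one_le_blockDecay (hθ₀ : 0 < θ) (hθ₁ : θ < 1) {n : ℤ} {y : ℝ}
    (h1 : (2 : ℝ) ^ n < y) (h2 : y ≤ (2 : ℝ) ^ (n + 1)) :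
    min 1 y ≤ 4 * (blockDecay θ ^ n.natAbs) ^ 2 * y ^ θ := by
  have hy : 0 < y := lt_trans (by positivity) h1
  rw [blockDecay_sq_pow]
  rcases le_total 0 n with hn | hn
  · refine (min_le_left _ _).trans ?_
    rw [Int.natAbs_of_nonneg hn]
    have hx : (1 : ℝ) ≤ 2 ^ n := one_le_zpow₀ (by norm_num) hn
    calc (1 : ℝ) = ((2 : ℝ) ^ n) ^ (-θ) * ((2 : ℝ) ^ n) ^ θ := by
          rw [← Real.rpow_add (by positivity)]; simp
      _ ≤ ((2 : ℝ) ^ n) ^ (-(min θ (1 - θ))) * y ^ θ := by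
          gcongr
          · exact min_le_left _ _
      _ ≤ _ := by
          rw [mul_assoc]
          exact le_mul_of_one_le_left (by positivity) (by norm_num)
  · refine (min_le_right _ _).trans ?_
    have hx : ((2 : ℝ) ^ (n.natAbs : ℤ)) = (2 ^ n)⁻¹ := by
      rw [← zpow_neg, Int.ofNat_natAbs_of_nonpos hn]
    have hx1 : (2 : ℝ) ^ n ≤ 1 := zpow_le_one_of_nonpos₀ (by norm_num) hn
    rw [hx, Real.inv_rpow (by positivity), ← Real.rpow_neg (by positivity), neg_neg]
    calc y = y ^ (1 - θ) * y ^ θ := by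
          rw [← Real.rpow_add hy]; simp
      _ ≤ (2 * ((2 : ℝ) ^ n) ^ (1 - θ)) * y ^ θ := by
          gcongr
          exact (Real.rpow_le_rpow hy.le h2 (by linarith)).trans
            (two_zpow_succ_rpow_le (by linarith) n)
      _ ≤ (4 * ((2 : ℝ) ^ n) ^ (min θ (1 - θ))) * y ^ θ := by
          refine mul_le_mul_of_nonneg_right ?_ (by positivity)
          refine mul_le_mul (by norm_num)
            (Real.rpow_le_rpow_of_exponent_ge (by positivity) hx1 (min_le_right _ _))
            (by positivity) (by norm_num)

theorem truncNorm_le_tsum_blockNorm (hμ : ∀ i, 0 < μ i) (hθ₀ : 0 < θ) (hθ₁ : θ < 1)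
    (b : I → ℝ) (k : ℤ) :
    ENNReal.ofReal (halfScale k ^ (-θ)) * truncNorm μ b (halfScale k) ≤
      2 * ∑' j, blockWeight θ (j - k) * blockNorm μ θ b j := by
  have hs := halfScale_pos k
  set A := halfScale k ^ (-θ) with hA
  have hA0 : 0 ≤ A := by positivity
  have hA2 : A ^ 2 = ((2 : ℝ) ^ k) ^ θ := halfScale_rpow_neg_sq θ k
  have hcover : ⋃ j, dyadicBlock μ j = univ := by
    refine eq_univ_of_forall fun i => mem_iUnion.2 ?_
    obtain ⟨j, hj⟩ := exists_mem_Ioc_zpow (inv_pos.2 (hμ i)) (one_lt_two (α := ℝ))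
    exact ⟨j, hj⟩
  set g : I → ℝ≥0∞ := fun i =>
    ENNReal.ofReal A ^ 2 * ENNReal.ofReal (min 1 (halfScale k ^ 2 / μ i) * b i ^ 2) with hg
  calc ENNReal.ofReal A * truncNorm μ b (halfScale k) = (∑' i, g i) ^ (1 / 2 : ℝ) := by
        rw [truncNorm, ← ENNReal.mul_rpow_half_sq, ← ENNReal.tsum_mul_left]
    _ ≤ (∑' j, ∑' i : dyadicBlock μ j, g i) ^ (1 / 2 : ℝ) := by
        gcongr ?_ ^ (1 / 2 : ℝ)
        -- Subadditivity over the covering by blocks suffices; disjointness plays no role.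
        rw [← tsum_univ, ← hcover]
        exact ENNReal.tsum_iUnion_le_tsum g _
    _ ≤ ∑' j, (∑' i : dyadicBlock μ j, g i) ^ (1 / 2 : ℝ) := ENNReal.tsum_rpow_half_le _
    _ ≤ ∑' j, 2 * (blockWeight θ (j - k) * blockNorm μ θ b j) := by
        refine ENNReal.tsum_le_tsum fun j => ?_
        rw [← mul_assoc, blockNorm, ← ENNReal.mul_rpow_half_sq, ← ENNReal.tsum_mul_left]
        gcongr ?_ ^ (1 / 2 : ℝ)
        refine ENNReal.tsum_le_tsum fun ⟨i, h1, h2⟩ => ?_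
        have hi := hμ i
        have hρ : 0 < blockDecay θ := blockDecay_pos
        simp only [hg, blockWeight]
        rw [show (2 : ℝ≥0∞) = ENNReal.ofReal 2 by norm_num, ← ENNReal.ofReal_mul (by norm_num),
          ← ENNReal.ofReal_pow (by positivity), ← ENNReal.ofReal_mul (by positivity),
          ← ENNReal.ofReal_pow (by positivity), ← ENNReal.ofReal_mul (by positivity)]
        refine ENNReal.ofReal_le_ofReal ?_
        have h2k : (0 : ℝ) < 2 ^ k := by positivity
        -- For `i ∈ M_j` this ratio lies in `(2^{j-k}, 2^{j-k+1}]`, so only `j - k` matters.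
        set y := halfScale k ^ 2 / μ i with hy
        have hyw : y = (μ i)⁻¹ / 2 ^ k := by rw [hy, halfScale_sq]; field_simp
        have hw : μ i ^ (-θ) = ((2 : ℝ) ^ k) ^ θ * y ^ θ := by
          rw [← Real.mul_rpow (by positivity) (by rw [hyw]; positivity), hyw,
            mul_div_cancel₀ _ h2k.ne', Real.inv_rpow hi.le, Real.rpow_neg hi.le]
        have hmin : min 1 y ≤ 4 * (blockDecay θ ^ (j - k).natAbs) ^ 2 * y ^ θ := by
          refine min_one_le_blockDecay hθ₀ hθ₁ ?_ ?_
          · rw [hyw, lt_div_iff₀ h2k, ← zpow_add₀ (by norm_num), sub_add_cancel]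
            exact h1
          · rw [hyw, div_le_iff₀ h2k, ← zpow_add₀ (by norm_num),
              show j - k + 1 + k = j + 1 by ring]
            exact h2
        rw [hw, hA2]
        calc ((2 : ℝ) ^ k) ^ θ * (min 1 y * b i ^ 2)
            ≤ ((2 : ℝ) ^ k) ^ θ *
              ((4 * (blockDecay θ ^ (j - k).natAbs) ^ 2 * y ^ θ) * b i ^ 2) := by gcongr
          _ = _ := by ring
    _ = _ := ENNReal.tsum_mul_left

theorem lrNorm_truncNorm_le (hμ : ∀ i, 0 < μ i) (hθ₀ : 0 < θ) (hθ₁ : θ < 1) {r : ℝ≥0∞}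
    (hr : 1 ≤ r) (b : I → ℝ) :
    lrNorm r (fun k => ENNReal.ofReal (halfScale k ^ (-θ)) * truncNorm μ b (halfScale k)) ≤
      2 * ((∑' n, blockWeight θ n) * sequenceNorm μ θ r b) :=
  calc _ ≤ lrNorm r fun k => 2 * ∑' j, blockWeight θ (j - k) * blockNorm μ θ b j :=
        lrNorm_mono (truncNorm_le_tsum_blockNorm hμ hθ₀ hθ₁ b)
    _ ≤ _ := by
        rw [lrNorm_const_mul hr]
        gcongr
        exact lrNorm_conv_le hr _ _

theorem sequenceNorm_le_lrNorm_truncNorm (hμ : ∀ i, 0 < μ i) (hθ₀ : 0 < θ) (hθ₁ : θ < 1)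
    {r : ℝ≥0∞} (hr : 1 ≤ r) (b : I → ℝ) :
    sequenceNorm μ θ r b ≤ 2 *
      lrNorm r (fun k => ENNReal.ofReal (halfScale k ^ (-θ)) * truncNorm μ b (halfScale k)) := by
  rw [← lrNorm_const_mul hr]
  exact lrNorm_mono (blockNorm_le_truncNorm hμ hθ₀ hθ₁ b)

end Truncation

/-! ### Orthonormal expansions -/

section Orthonormal

variable {I E : Type*} [NormedAddCommGroup E] [InnerProductSpace ℝ E] {v : I → E}

theorem Orthonormal.inner_eq_of_hasSum (hv : Orthonormal ℝ v) {a : I → ℝ} {x : E}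
    (hx : HasSum (fun i => a i • v i) x) (i : I) : ⟪v i, x⟫_ℝ = a i := by
  classical
  have h1 := hx.mapL (innerSL ℝ (v i))
  have h2 : (fun j => innerSL ℝ (v i) (a j • v j)) = fun j => if j = i then a i else 0 := by
    funext j
    rw [innerSL_apply_apply, inner_smul_right, orthonormal_iff_ite.mp hv i j]
    by_cases hij : j = i
    · subst hij; simp
    · simp [hij, Ne.symm hij]
  rw [h2] at h1
  exact h1.unique (hasSum_ite_eq i (a i))

theorem Orthonormal.hasSum_sq (hv : Orthonormal ℝ v) {a : I → ℝ} {x : E}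
    (hx : HasSum (fun i => a i • v i) x) : HasSum (fun i => a i ^ 2) (‖x‖ ^ 2) := by
  have h1 := hx.mapL (innerSL ℝ x)
  rw [innerSL_apply_apply, real_inner_self_eq_norm_sq] at h1
  have h2 : (fun i => innerSL ℝ x (a i • v i)) = fun i => a i ^ 2 := by
    funext i
    rw [innerSL_apply_apply, inner_smul_right, real_inner_comm, hv.inner_eq_of_hasSum hx i, sq]
  rwa [h2] at h1

theorem Orthonormal.summable_smul [CompleteSpace E] (hv : Orthonormal ℝ v) {a : I → ℝ}
    (ha : Summable fun i => a i ^ 2) : Summable fun i => a i • v i := by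
  have := (hv.orthogonalFamily.summable_iff_norm_sq_summable a).2 (by simpa using ha)
  simpa using this

/-- By Bessel the Fourier series converges to some `y`. Then `x - y` lies in the closed span and is
orthogonal to it, hence vanishes. -/
theorem Orthonormal.hasSum_of_mem_closure [CompleteSpace E] (hv : Orthonormal ℝ v) {x : E}
    (hx : x ∈ closure (Submodule.span ℝ (range v) : Set E)) :
    HasSum (fun i => ⟪v i, x⟫_ℝ • v i) x := by
  have hs : Summable fun i => ⟪v i, x⟫_ℝ • v i :=
    hv.summable_smul (by simpa using hv.inner_products_summable x)
  obtain ⟨y, hy⟩ := hs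
  have hyc : y ∈ (Submodule.span ℝ (range v)).topologicalClosure := by
    refine mem_closure_of_tendsto hy (Filter.Eventually.of_forall fun s => ?_)
    exact Submodule.sum_mem _ fun i _ =>
      Submodule.smul_mem _ _ (Submodule.subset_span (mem_range_self i))
  have hxy : x - y ∈ (Submodule.span ℝ (range v)).topologicalClosure := Submodule.sub_mem _ hx hyc
  have hperp : x - y ∈ (Submodule.span ℝ (range v)).topologicalClosureᗮ := by
    rw [Submodule.orthogonal_closure, Submodule.mem_orthogonal]
    intro u hu
    induction hu using Submodule.span_induction with
    | mem u hu =>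
      obtain ⟨i, rfl⟩ := hu
      rw [inner_sub_right, hv.inner_eq_of_hasSum hy, sub_self]
    | zero => simp
    | add u w _ _ h1 h2 => rw [inner_add_left, h1, h2, add_zero]
    | smul c u _ h1 => rw [inner_smul_left, h1, mul_zero]
  have h0 : x - y = 0 := by
    have := Submodule.inner_right_of_mem_orthogonal hxy hperp
    exact inner_self_eq_zero.1 this
  rwa [← sub_eq_zero.1 h0] at hy

end Orthonormal

/-! ### Singular systems -/

section SingularSystem

variable {I E H : Type*} [NormedAddCommGroup E] [InnerProductSpace ℝ E]
  [NormedAddCommGroup H] [InnerProductSpace ℝ H] [CompleteSpace H]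
  {S : H →L[ℝ] E} {μ : I → ℝ} {e : I → H}

open ContinuousLinearMap in
-- `S` need not be injective, so it cannot be cancelled in `hT`. Instead `‖S^* S e_i - μ_i e_i‖² =
-- μ_i - 2 μ_i + μ_i² ‖e_i‖² = 0`, as `‖e_i‖² = 1 / μ_i`.
theorem adjoint_apply_eq_smul [CompleteSpace E] (hμ : ∀ i, 0 < μ i)
    (hu : Orthonormal ℝ fun i => S (e i)) (hv : Orthonormal ℝ fun i => √(μ i) • e i)
    (hT : ∀ i, S (adjoint S (S (e i))) = μ i • S (e i)) (i : I) :
    adjoint S (S (e i)) = μ i • e i := by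
  have hi := hμ i
  have h1 : ⟪S (e i), S (e i)⟫_ℝ = 1 := by
    rw [real_inner_self_eq_norm_sq, hu.1 i, one_pow]
  have h2 : μ i * ⟪e i, e i⟫_ℝ = 1 := by
    have := hv.1 i
    rw [norm_smul, Real.norm_of_nonneg (Real.sqrt_nonneg _)] at this
    rw [real_inner_self_eq_norm_sq, ← Real.sq_sqrt hi.le, ← mul_pow, this, one_pow]
  have h3 : ⟪adjoint S (S (e i)), adjoint S (S (e i))⟫_ℝ = μ i := by
    rw [adjoint_inner_left, hT, inner_smul_right, h1, mul_one]
  have h4 : ⟪adjoint S (S (e i)), e i⟫_ℝ = 1 := by rw [adjoint_inner_left, h1]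
  rw [← sub_eq_zero, ← inner_self_eq_zero (𝕜 := ℝ), inner_sub_left, inner_sub_right,
    inner_sub_right, h3, real_inner_smul_right, real_inner_smul_left, real_inner_smul_left,
    real_inner_smul_right, h4, real_inner_comm, h4, h2]
  ring

theorem ENNReal.sum_ofReal_sq_rpow_half_le {J : Type*} (s : Finset J) (x : J → ℝ) {M : ℝ}
    (hM : 0 ≤ M) (h : ∑ i ∈ s, x i ^ 2 ≤ M ^ 2) :
    (∑ i ∈ s, ENNReal.ofReal |x i| ^ (2 : ℝ)) ^ (1 / (2 : ℝ)) ≤ ENNReal.ofReal M := by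
  have h1 : ∀ i, ENNReal.ofReal |x i| ^ (2 : ℝ) = ENNReal.ofReal (x i ^ 2) := fun i => by
    rw [ENNReal.ofReal_rpow_of_nonneg (abs_nonneg _) (by norm_num), Real.rpow_two, sq_abs]
  simp_rw [h1]
  rw [← ENNReal.ofReal_sum_of_nonneg fun i _ => sq_nonneg _,
    ENNReal.ofReal_rpow_of_nonneg (Finset.sum_nonneg fun i _ => sq_nonneg _) (by norm_num),
    ← Real.sqrt_eq_rpow]
  exact ENNReal.ofReal_le_ofReal ((Real.sqrt_le_sqrt h).trans_eq (Real.sqrt_sq hM))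

open ContinuousLinearMap in
/-- The truncated norm of the coefficients of `f` is a lower bound for the `K`-functional. -/
theorem truncNorm_le [CompleteSpace E] (hμ : ∀ i, 0 < μ i)
    (hu : Orthonormal ℝ fun i => S (e i))
    (hv : Orthonormal ℝ fun i => √(μ i) • e i)
    (hS : ∀ i, adjoint S (S (e i)) = μ i • e i) {t : ℝ} (ht : 0 < t) (f : E) (g : H) :
    truncNorm μ (fun i => ⟪S (e i), f⟫_ℝ) t ≤ ENNReal.ofReal (‖f - S g‖ + t * ‖g‖) := by
  set x : I → ℝ := fun i => ⟪S (e i), f - S g⟫_ℝ with hx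
  set y : I → ℝ := fun i => t * ⟪√(μ i) • e i, g⟫_ℝ with hy
  have hcoef : ∀ i, ⟪S (e i), f⟫_ℝ = x i + √(μ i) * ⟪√(μ i) • e i, g⟫_ℝ := by
    intro i
    have : ⟪S (e i), S g⟫_ℝ = √(μ i) * ⟪√(μ i) • e i, g⟫_ℝ := by
      rw [← adjoint_inner_left, hS, real_inner_smul_left, real_inner_smul_left, ← mul_assoc,
        Real.mul_self_sqrt (hμ i).le]
    rw [hx, ← this]
    simp only
    rw [← inner_add_right, sub_add_cancel]
  -- The root of the truncation factor is `min(1, t/√μ_i)`: it is bounded by 1 on the residual part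
  -- `x` and by `t/√μ_i` on the part from `g`. Minkowski and Bessel in `L²` and in `H` then finish.
  have hterm : ∀ i, ENNReal.ofReal (min 1 (t ^ 2 / μ i) * ⟪S (e i), f⟫_ℝ ^ 2) ≤
      (ENNReal.ofReal |x i| + ENNReal.ofReal |y i|) ^ (2 : ℝ) := by
    intro i
    have hi := hμ i
    have hsi : 0 < √(μ i) := Real.sqrt_pos.2 hi
    rw [← ENNReal.ofReal_add (abs_nonneg _) (abs_nonneg _),
      ENNReal.ofReal_rpow_of_nonneg (by positivity) (by norm_num), Real.rpow_two]
    refine ENNReal.ofReal_le_ofReal ?_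
    have hκ : min 1 (t ^ 2 / μ i) = (min 1 (t / √(μ i))) ^ 2 := by
      have h0 : 0 ≤ t / √(μ i) := by positivity
      have : t ^ 2 / μ i = (t / √(μ i)) ^ 2 := by rw [div_pow, Real.sq_sqrt hi.le]
      rw [this]
      rcases le_total 1 (t / √(μ i)) with h | h
      · rw [min_eq_left h, min_eq_left (by nlinarith), one_pow]
      · rw [min_eq_right h, min_eq_right (by nlinarith)]
    have hm0 : 0 ≤ min 1 (t / √(μ i)) := le_min zero_le_one (by positivity)
    rw [hκ, ← mul_pow, ← sq_abs]
    gcongr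
    rw [abs_mul, abs_of_nonneg hm0, hcoef]
    set z := ⟪√(μ i) • e i, g⟫_ℝ with hz
    calc min 1 (t / √(μ i)) * |x i + √(μ i) * z|
        ≤ min 1 (t / √(μ i)) * (|x i| + √(μ i) * |z|) := by
          gcongr
          refine (abs_add_le _ _).trans_eq ?_
          rw [abs_mul, abs_of_pos hsi]
      _ ≤ 1 * |x i| + (t / √(μ i)) * (√(μ i) * |z|) := by
          rw [mul_add]
          gcongr
          · exact min_le_left _ _
          · exact min_le_right _ _
      _ = |x i| + |y i| := by
          rw [hy]
          simp only
          rw [abs_mul, abs_of_pos ht, ← hz]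
          field_simp
  rw [truncNorm, ENNReal.tsum_eq_iSup_sum,
    (ENNReal.monotone_rpow_of_nonneg (by norm_num : (0 : ℝ) ≤ 1 / 2)).map_iSup_of_continuousAt
      ENNReal.continuous_rpow_const.continuousAt (by simp)]
  refine iSup_le fun s => ?_
  calc (∑ i ∈ s, ENNReal.ofReal (min 1 (t ^ 2 / μ i) * ⟪S (e i), f⟫_ℝ ^ 2)) ^ (1 / 2 : ℝ)
      ≤ (∑ i ∈ s, (ENNReal.ofReal |x i| + ENNReal.ofReal |y i|) ^ (2 : ℝ)) ^ (1 / 2 : ℝ) := by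
        gcongr with i
        exact hterm i
    _ ≤ (∑ i ∈ s, ENNReal.ofReal |x i| ^ (2 : ℝ)) ^ (1 / (2 : ℝ)) +
        (∑ i ∈ s, ENNReal.ofReal |y i| ^ (2 : ℝ)) ^ (1 / (2 : ℝ)) :=
        ENNReal.Lp_add_le s _ _ (by norm_num)
    _ ≤ ENNReal.ofReal ‖f - S g‖ + ENNReal.ofReal (t * ‖g‖) := by
        gcongr
        · refine ENNReal.sum_ofReal_sq_rpow_half_le s x (norm_nonneg _) ?_
          simpa using hu.sum_inner_products_le (f - S g) (s := s)
        · refine ENNReal.sum_ofReal_sq_rpow_half_le s y (by positivity) ?_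
          simp only [hy, mul_pow]
          rw [← Finset.mul_sum]
          gcongr
          simpa using hv.sum_inner_products_le g (s := s)
    _ = _ := (ENNReal.ofReal_add (norm_nonneg _) (by positivity)).symm

/-- Up to a factor, the truncated norm of `b` is an upper bound for the `K`-functional of
`∑ b_i S e_i`. -/
theorem exists_le_truncNorm (hμ : ∀ i, 0 < μ i) (hu : Orthonormal ℝ fun i => S (e i))
    (hv : Orthonormal ℝ fun i => √(μ i) • e i) {b : I → ℝ} {f : E}
    (hb : HasSum (fun i => b i • S (e i)) f) {t : ℝ} (ht : 0 < t) :
    ∃ g : H, ENNReal.ofReal (‖f - S g‖ + t * ‖g‖) ≤ 2 * truncNorm μ b t := by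
  classical
  have hb2 := (hu.hasSum_sq hb).summable
  set m : I → ℝ := fun i => min 1 (t ^ 2 / μ i) * b i ^ 2 with hm
  have hm0 : ∀ i, 0 ≤ m i := fun i => by
    have := hμ i
    have : 0 ≤ min 1 (t ^ 2 / μ i) := le_min zero_le_one (by positivity)
    positivity
  have hms : Summable m := by
    refine Summable.of_nonneg_of_le hm0 (fun i => ?_) hb2
    exact mul_le_of_le_one_left (sq_nonneg _) (min_le_left _ _)
  set M := ∑' i, m i with hM
  have hM0 : 0 ≤ M := tsum_nonneg hm0
  have htr : truncNorm μ b t = ENNReal.ofReal √M := by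
    rw [truncNorm, ← ENNReal.ofReal_tsum_of_nonneg hm0 hms,
      ENNReal.ofReal_rpow_of_nonneg hM0 (by norm_num), Real.sqrt_eq_rpow]
  -- Coordinates of `g` in the system `√(μ i) • e i`: the coefficient `b i` is reproduced exactly
  -- where `t² / μ_i < 1` and dropped elsewhere. Both `‖f - S g‖` and `t ‖g‖` are then at most `√M`.
  set a : I → ℝ := fun i => if t ^ 2 < μ i then b i / √(μ i) else 0 with ha
  have hat : ∀ i, (t * a i) ^ 2 ≤ m i := by
    intro i
    have hi := hμ i
    by_cases h : t ^ 2 < μ i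
    · have h1 : t ^ 2 / μ i ≤ 1 := (div_le_one hi).2 h.le
      simp only [ha, hm, h, if_true, min_eq_right h1, mul_pow, div_pow, Real.sq_sqrt hi.le]
      apply le_of_eq
      field_simp
    · simpa [ha, h] using hm0 i
  have has : Summable fun i => a i ^ 2 := by
    have := (Summable.of_nonneg_of_le (fun i => sq_nonneg _) hat hms).mul_left (t ^ 2)⁻¹
    refine this.congr fun i => ?_
    field_simp
  obtain ⟨g, hg⟩ := hv.summable_smul has
  have hgn : (t * ‖g‖) ^ 2 ≤ M := by
    have h1 := (hv.hasSum_sq hg).mul_left (t ^ 2)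
    rw [← mul_pow] at h1
    refine hasSum_le (fun i => ?_) h1 hms.hasSum
    rw [← mul_pow]
    exact hat i
  have hSg : HasSum (fun i => (a i * √(μ i)) • S (e i)) (S g) := by
    simpa [smul_smul] using hg.mapL S
  have hdiff : HasSum (fun i => (b i - a i * √(μ i)) • S (e i)) (f - S g) := by
    simpa [sub_smul] using hb.sub hSg
  have hfn : ‖f - S g‖ ^ 2 ≤ M := by
    refine hasSum_le (fun i => ?_) (hu.hasSum_sq hdiff) hms.hasSum
    have hi := hμ i
    by_cases h : t ^ 2 < μ i
    · have : 0 < √(μ i) := Real.sqrt_pos.2 hi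
      have h0 : b i - b i / √(μ i) * √(μ i) = 0 := by field_simp; ring
      simpa [ha, h, h0] using hm0 i
    · have h1 : 1 ≤ t ^ 2 / μ i := (one_le_div hi).2 (not_lt.1 h)
      simp [ha, hm, h, h1]
  refine ⟨g, ?_⟩
  rw [htr, show (2 : ℝ≥0∞) = ENNReal.ofReal 2 by norm_num, ← ENNReal.ofReal_mul (by norm_num)]
  refine ENNReal.ofReal_le_ofReal ?_
  have h1 := Real.le_sqrt_of_sq_le hfn
  have h2 := Real.le_sqrt_of_sq_le hgn
  linarith

end SingularSystem

/-! ### Enumeration of null families in non-increasing order -/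

section Enumeration

/-- The rank `j ↦ #{i < j}` is strictly monotone and its image is an initial segment of `ℕ`: the
largest element below `j` has rank one less. `N` is the first rank missed, or `⊤`. -/
theorem exists_orderIso_indexSet (J : Type*) [LinearOrder J] (hJ : ∀ j : J, (Iio j).Finite) :
    ∃ N : ℕ∞, Nonempty (IndexSet N ≃o J) := by
  classical
  set rank : J → ℕ := fun j => (Iio j).ncard with hrank
  have hmono : StrictMono rank := fun i j hij =>
    ncard_lt_ncard (Iio_ssubset_Iio hij) (hJ j)
  have hpred : ∀ m, (∃ j, rank j = m + 1) → ∃ j, rank j = m := by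
    rintro m ⟨j, hj⟩
    have hne : (Iio j).Nonempty := by
      rw [← ncard_pos (hJ j)]
      exact (Nat.succ_pos m).trans_eq hj.symm
    obtain ⟨i, hi, hmax⟩ := (hJ j).exists_maximalFor id _ hne
    have hins : Iio j = insert i (Iio i) := by
      ext x
      simp only [mem_Iio, mem_insert_iff]
      constructor
      · intro hx
        rcases lt_trichotomy x i with h | h | h
        · exact Or.inr h
        · exact Or.inl h
        · exact absurd (hmax hx h.le) (not_le.2 h)
      · rintro (rfl | hx)
        · exact hi
        · exact hx.trans hi
    refine ⟨i, ?_⟩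
    have h1 : rank j = rank i + 1 := by
      simp only [hrank]
      rw [hins, ncard_insert_of_notMem (by simp) (hJ i)]
    omega
  have hdown : ∀ m n, m ≤ n → (∃ j, rank j = n) → ∃ j, rank j = m := fun m n hmn => by
    induction hmn with
    | refl => exact id
    | step _ ih => exact fun h => ih (hpred _ h)
  obtain ⟨N, hN⟩ : ∃ N : ℕ∞, ∀ n : ℕ, (n : ℕ∞) < N ↔ ∃ j, rank j = n := by
    by_cases h : ∀ n, ∃ j, rank j = n
    · exact ⟨⊤, fun n => ⟨fun _ => h n, fun _ => ENat.natCast_lt_top n⟩⟩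
    · push Not at h
      have h' : ∃ n, ¬ ∃ j, rank j = n := by simpa using h
      refine ⟨(Nat.find h' : ℕ), fun n => ?_⟩
      rw [Nat.cast_lt]
      refine ⟨fun hn => not_not.1 (Nat.find_min h' hn), fun hn => ?_⟩
      by_contra hle
      exact Nat.find_spec h' (hdown _ _ (not_lt.1 hle) hn)
  let φ : J → IndexSet N := fun j => ⟨rank j, (hN _).2 ⟨j, rfl⟩⟩
  have hφ : StrictMono φ := fun i j hij => hmono hij
  have hsurj : Function.Surjective φ := fun ⟨n, hn⟩ => by
    obtain ⟨j, hj⟩ := (hN n).1 hn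
    exact ⟨j, Subtype.ext hj⟩
  exact ⟨N, ⟨(hφ.orderIsoOfSurjective φ hsurj).symm⟩⟩

theorem exists_antitone_enumeration {J : Type*} (w : J → ℝ) (hpos : ∀ j, 0 < w j)
    (hfin : ∀ ε, 0 < ε → {j | ε ≤ w j}.Finite) :
    ∃ (N : ℕ∞) (σ : IndexSet N ≃ J), Antitone fun i => w (σ i) := by
  have hcount : Countable J := by
    rw [← countable_univ_iff]
    have : (univ : Set J) = ⋃ n : ℕ, {j | 1 / ((n : ℝ) + 1) ≤ w j} := by
      refine (eq_univ_of_forall fun j => mem_iUnion.2 ?_).symm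
      obtain ⟨n, hn⟩ := exists_nat_one_div_lt (hpos j)
      exact ⟨n, hn.le⟩
    rw [this]
    exact countable_iUnion fun n => (hfin _ (by positivity)).countable
  obtain ⟨enc, henc⟩ := hcount.exists_injective_nat
  -- Larger values of `w` come first, and ties are broken by an arbitrary injection into `ℕ`. Only
  -- the finitely many indices with `w ≥ w j` can precede `j`.
  let key : J → ℝᵒᵈ ×ₗ ℕ := fun j => toLex (OrderDual.toDual (w j), enc j)
  have hkey : Function.Injective key := fun i j hij => by
    have := congrArg (fun x => (ofLex x).2) hij
    exact henc this
  let : LinearOrder J := LinearOrder.lift' key hkey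
  have hle : ∀ i j : J, i ≤ j → w j ≤ w i := by
    intro i j hij
    have h1 : key i ≤ key j := hij
    rw [Prod.Lex.le_iff] at h1
    rcases h1 with h | h
    · exact le_of_lt h
    · exact (OrderDual.toDual.injective h.1).symm.le
  obtain ⟨N, ⟨σ⟩⟩ := exists_orderIso_indexSet J fun j =>
    (hfin (w j) (hpos j)).subset fun i hi => hle i j (le_of_lt hi)
  exact ⟨N, σ.toEquiv, fun a b hab => hle _ _ (σ.monotone hab)⟩

end Enumeration

/-! ### The spectral decomposition of `S S^*` -/

section Spectral

open Module.End

variable {E : Type*} [NormedAddCommGroup E] [InnerProductSpace ℝ E]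

/-- The images of distinct `u_i`, `u_j` are at distance `√(w_i² + w_j²)`. If `w ≥ ε` infinitely
often, these images would have no Cauchy subsequence. -/
theorem IsCompactOperator.finite_setOf_le_of_orthonormal {T : E →L[ℝ] E} (hT : IsCompactOperator T)
    {J : Type*} {u : J → E} (hu : Orthonormal ℝ u) {w : J → ℝ} (hw : ∀ j, T (u j) = w j • u j)
    {ε : ℝ} (hε : 0 < ε) : {j | ε ≤ w j}.Finite := by
  by_contra hinf
  have hinf : {j | ε ≤ w j}.Infinite := hinf
  set x : ℕ → J := fun n => hinf.natEmbedding _ n with hx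
  have hxε : ∀ n, ε ≤ w (x n) := fun n => (hinf.natEmbedding _ n).2
  have hxinj : Function.Injective x :=
    Subtype.val_injective.comp (hinf.natEmbedding _).injective
  obtain ⟨K, hK, hsub⟩ := hT.image_closedBall_subset_compact (𝕜₁ := ℝ) (f := (T : E →ₗ[ℝ] E)) 1
  have hmem : ∀ n, T (u (x n)) ∈ K := fun n =>
    hsub ⟨u (x n), by simp [hu.1], rfl⟩
  obtain ⟨a, -, φ, hφ, hlim⟩ := hK.tendsto_subseq hmem
  have hcauchy := hlim.cauchySeq
  obtain ⟨n, hn⟩ := Metric.cauchySeq_iff.1 hcauchy ε hε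
  have hlt := hn n le_rfl (n + 1) (Nat.le_succ n)
  set i := x (φ n) with hi
  set j := x (φ (n + 1)) with hj
  have hij : i ≠ j := fun h => absurd (hφ.injective (hxinj h)) (by omega)
  have horth : ⟪u i, u j⟫_ℝ = 0 := hu.2 hij
  have hdist : dist (T (u i)) (T (u j)) ^ 2 = w i ^ 2 + w j ^ 2 := by
    rw [dist_eq_norm, hw, hw, @norm_sub_sq ℝ, real_inner_smul_left, real_inner_smul_right, horth,
      norm_smul, norm_smul, hu.1, hu.1]
    simp
  have h1 : dist (T (u i)) (T (u j)) < ε := hlt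
  have h2 : 0 ≤ dist (T (u i)) (T (u j)) := dist_nonneg
  have h3 : ε ≤ w i := hxε _
  nlinarith [sq_nonneg (w j)]

/-- Split `x = p + z` along the kernel of `T`. By symmetry `p` is orthogonal to the other
eigenspaces, so `z` is orthogonal to all of them and the spectral theorem gives `z = 0`. -/
theorem ContinuousLinearMap.apply_eq_zero_of_forall_mem_eigenspace [CompleteSpace E]
    {T : E →L[ℝ] E} (hT : IsCompactOperator T) (hsymm : T.IsSymmetric) {x : E}
    (hx : ∀ c : ℝ, c ≠ 0 → ∀ y ∈ eigenspace (T : E →ₗ[ℝ] E) c, ⟪y, x⟫_ℝ = 0) : T x = 0 := by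
  set V := eigenspace (T : E →ₗ[ℝ] E) 0 with hV
  have hVker : ∀ y, y ∈ V ↔ T y = 0 := fun y => by
    rw [hV, mem_eigenspace_iff, zero_smul]; rfl
  have hclosed : IsClosed (V : Set E) := by
    have : (V : Set E) = T ⁻¹' {0} := by ext y; simp [hVker]
    rw [this]
    exact isClosed_singleton.preimage T.continuous
  have : CompleteSpace V := hclosed.completeSpace_coe
  obtain ⟨p, hp, z, hz, hpz⟩ := V.exists_add_mem_mem_orthogonal x
  have hz0 : z = 0 := by
    have hmem : z ∈ (⨆ c, eigenspace (T : E →ₗ[ℝ] E) c)ᗮ := by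
      rw [← Submodule.iInf_orthogonal, Submodule.mem_iInf]
      intro c
      rw [Submodule.mem_orthogonal]
      intro y hy
      by_cases hc : c = 0
      · subst hc
        exact (Submodule.mem_orthogonal _ _).1 hz y hy
      · have h1 := hx c hc y hy
        have h2 : ⟪y, p⟫_ℝ = 0 := by
          have h3 : T y = c • y := mem_eigenspace_iff.1 hy
          have h4 : ⟪T y, p⟫_ℝ = ⟪y, T p⟫_ℝ := hsymm y p
          rw [h3, (hVker p).1 hp, inner_zero_right, real_inner_smul_left] at h4
          exact (mul_eq_zero.1 h4).resolve_left hc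
        rw [hpz, inner_add_right, h2, zero_add] at h1
        exact h1
    rw [ContinuousLinearMap.orthogonalComplement_iSup_eigenspaces_eq_bot hT hsymm] at hmem
    exact (Submodule.mem_bot ℝ).1 hmem
  rw [hpz, hz0, add_zero]
  exact (hVker p).1 hp

end Spectral

section Adjoint

open Module.End ContinuousLinearMap

variable {E H : Type*} [NormedAddCommGroup E] [InnerProductSpace ℝ E] [CompleteSpace E]
  [NormedAddCommGroup H] [InnerProductSpace ℝ H] [CompleteSpace H] {S : H →L[ℝ] E}

theorem isSymmetric_comp_adjoint (S : H →L[ℝ] E) : (S ∘L adjoint S).IsSymmetric := fun x y => by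
  change ⟪S (adjoint S x), y⟫_ℝ = ⟪x, S (adjoint S y)⟫_ℝ
  rw [← adjoint_inner_right, adjoint_inner_left]

/-- Compact operators `S` have a singular system. -/
theorem exists_singularSystem (hS : IsCompactOperator S) :
    ∃ (N : ℕ∞) (μ : IndexSet N → ℝ) (e : IndexSet N → H), Antitone μ ∧ (∀ i, μ i ≠ 0) ∧
      (Orthonormal ℝ fun i => S (e i)) ∧ (Orthonormal ℝ fun i => √(μ i) • e i) ∧
      ∀ c : ℝ, c ≠ 0 → Submodule.span ℝ ((fun i => S (e i)) '' {i | μ i = c}) =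
        eigenspace ((S ∘L adjoint S : E →L[ℝ] E) : E →ₗ[ℝ] E) c := by
  classical
  set T : E →L[ℝ] E := S ∘L adjoint S with hT
  have hTc : IsCompactOperator T := hS.comp_clm (adjoint S)
  have hsymm : T.IsSymmetric := isSymmetric_comp_adjoint S
  let Λ : Type := {c : ℝ // c ≠ 0 ∧ HasEigenvalue (T : E →ₗ[ℝ] E) c}
  have hfd : ∀ c : Λ, FiniteDimensional ℝ (eigenspace (T : E →ₗ[ℝ] E) c.1) := fun c =>
    finite_dimensional_eigenspace hTc c.1 c.2.1
  let J : Type := Σ c : Λ, Fin (Module.finrank ℝ (eigenspace (T : E →ₗ[ℝ] E) c.1))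
  let β := fun c : Λ => stdOrthonormalBasis ℝ (eigenspace (T : E →ₗ[ℝ] E) c.1)
  let u : J → E := fun j => (β j.1 j.2 : E)
  have hfam : OrthogonalFamily ℝ (fun c : Λ => eigenspace (T : E →ₗ[ℝ] E) c.1)
      fun c => (eigenspace (T : E →ₗ[ℝ] E) c.1).subtypeₗᵢ :=
    (LinearMap.IsSymmetric.orthogonalFamily_eigenspaces hsymm).comp Subtype.val_injective
  have hu : Orthonormal ℝ u := hfam.orthonormal_sigma_orthonormal fun c => (β c).orthonormal
  have hTu : ∀ j : J, T (u j) = j.1.1 • u j := fun j => mem_eigenspace_iff.1 (β j.1 j.2).2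
  have hpos : ∀ j : J, 0 < j.1.1 := fun j => by
    refine lt_of_le_of_ne ?_ j.1.2.1.symm
    -- The eigenvalue is `‖S^* u_j‖²`, hence non-negative.
    have h1 : ⟪adjoint S (u j), adjoint S (u j)⟫_ℝ = j.1.1 := by
      rw [adjoint_inner_left]
      change ⟪u j, T (u j)⟫_ℝ = _
      rw [hTu, real_inner_smul_right, real_inner_self_eq_norm_sq, hu.1, one_pow, mul_one]
    rw [← h1]
    exact real_inner_self_nonneg
  obtain ⟨N, σ, hσ⟩ := exists_antitone_enumeration (fun j : J => j.1.1) hpos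
    fun ε hε => hTc.finite_setOf_le_of_orthonormal hu hTu hε
  set μ : IndexSet N → ℝ := fun i => (σ i).1.1 with hμ
  have hμpos : ∀ i, 0 < μ i := fun i => hpos (σ i)
  -- The preimage of `u (σ i)` under `S` given by the eigenvalue equation; `⟪e i, e j⟫ = μ_i⁻¹ δ_ij`
  -- then follows by moving `S^*` across.
  set e : IndexSet N → H := fun i => (μ i)⁻¹ • adjoint S (u (σ i)) with he
  have hSe : ∀ i, S (e i) = u (σ i) := fun i => by
    rw [he]
    simp only
    rw [map_smul]
    change (μ i)⁻¹ • T (u (σ i)) = _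
    rw [hTu, smul_smul, inv_mul_cancel₀ (hμpos i).ne', one_smul]
  have hSe' : (fun i => S (e i)) = u ∘ σ := funext hSe
  refine ⟨N, μ, e, hσ, fun i => (hμpos i).ne', ?_, ?_, ?_⟩
  · rw [hSe']
    exact hu.comp σ σ.injective
  · rw [orthonormal_iff_ite]
    intro i j
    have hi := hμpos i
    have hj := hμpos j
    have h1 : ⟪e i, e j⟫_ℝ = (μ i)⁻¹ * if i = j then 1 else 0 := by
      have h2 : e i = (μ i)⁻¹ • adjoint S (u (σ i)) := rfl
      rw [h2, real_inner_smul_left, adjoint_inner_left, hSe,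
        orthonormal_iff_ite.1 (hu.comp σ σ.injective) i j |>.symm]
      rfl
    rw [real_inner_smul_left, real_inner_smul_right, h1]
    split_ifs with hij
    · subst hij
      rw [mul_one, ← mul_assoc, Real.mul_self_sqrt hi.le, mul_inv_cancel₀ hi.ne']
    · simp
  · intro c hc
    have himage : (fun i => S (e i)) '' {i | μ i = c} = u '' {j | j.1.1 = c} := by
      rw [hSe', image_comp]
      congr 1
      ext j
      constructor
      · rintro ⟨i, hi, rfl⟩
        exact hi
      · exact fun hj => ⟨σ.symm j, by simpa [hμ] using hj, by simp⟩
    rw [himage]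
    by_cases hev : HasEigenvalue (T : E →ₗ[ℝ] E) c
    · let c' : Λ := ⟨c, hc, hev⟩
      have hrange : u '' {j | j.1.1 = c} =
          (eigenspace (T : E →ₗ[ℝ] E) c).subtype '' range (β c') := by
        ext x
        constructor
        · rintro ⟨⟨d, i⟩, hd, rfl⟩
          obtain rfl : d = c' := Subtype.ext hd
          exact ⟨_, ⟨i, rfl⟩, rfl⟩
        · rintro ⟨_, ⟨i, rfl⟩, rfl⟩
          exact ⟨⟨c', i⟩, rfl, rfl⟩
      rw [hrange, Submodule.span_image, ← OrthonormalBasis.coe_toBasis, Module.Basis.span_eq,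
        Submodule.map_top, Submodule.range_subtype]
    · have hempty : {j : J | j.1.1 = c} = ∅ := by
        refine eq_empty_of_forall_notMem fun j (hj : j.1.1 = c) => hev ?_
        rw [← hj]
        exact j.1.2.2
      rw [hempty, image_empty, Submodule.span_empty]
      rw [hasEigenvalue_iff, not_not] at hev
      exact hev.symm

/-- The eigenvectors of `S S^*` for the non-zero eigenvalues are complete in the closure of the
range of `S`. -/
theorem closure_range_subset_closure_span (hS : IsCompactOperator S) {I : Type*} {u : I → E}
    (hu : ∀ c : ℝ, c ≠ 0 → eigenspace ((S ∘L adjoint S : E →L[ℝ] E) : E →ₗ[ℝ] E) c ≤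
      Submodule.span ℝ (range u)) :
    closure (range S) ⊆ closure (Submodule.span ℝ (range u) : Set E) := by
  refine closure_minimal ?_ isClosed_closure
  rintro _ ⟨g, rfl⟩
  rw [← Submodule.topologicalClosure_coe, SetLike.mem_coe,
    ← Submodule.orthogonal_orthogonal_eq_closure, Submodule.mem_orthogonal]
  intro x hx
  -- A vector orthogonal to all these eigenvectors is killed by `S S^*`; then `‖S^* x‖² = ⟪x, S S^*
  -- x⟫ = 0`, so it is orthogonal to the range of `S`.
  have h0 : (S ∘L adjoint S) x = 0 := by
    refine apply_eq_zero_of_forall_mem_eigenspace (hS.comp_clm (adjoint S))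
      (isSymmetric_comp_adjoint S) fun c hc y hy => ?_
    exact (Submodule.mem_orthogonal _ _).1 hx y (hu c hc hy)
  have h1 : adjoint S x = 0 := by
    rw [← inner_self_eq_zero (𝕜 := ℝ), adjoint_inner_left]
    change ⟪x, (S ∘L adjoint S) x⟫_ℝ = 0
    rw [h0, inner_zero_right]
  rw [← adjoint_inner_left, h1, inner_zero_left]

end Adjoint

/-! ### The `K`-functional of a compactly embedded reproducing kernel Hilbert space -/

namespace CompactlyEmbedded

variable {X : Type*} [MeasurableSpace X] {ν : Measure X}
  {H : Type*} [NormedAddCommGroup H] [InnerProductSpace ℝ H] [RKHS ℝ H X ℝ]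
  (h : CompactlyEmbedded H ν)

theorem isCompactOperator_embedding : IsCompactOperator h.embedding := h.isCompactOperator

theorem quotientNorm_nonneg (u : h.classes) : 0 ≤ h.quotientNorm u :=
  Real.iInf_nonneg fun g => norm_nonneg (g : H)

theorem KFunctional_bddBelow {t : ℝ} (ht : 0 ≤ t) (f : Lp ℝ 2 ν) :
    BddBelow (range fun y : h.classes => ‖f - (y : Lp ℝ 2 ν)‖ + t * h.quotientNorm y) := by
  refine ⟨0, ?_⟩
  rintro _ ⟨y, rfl⟩
  have := h.quotientNorm_nonneg y
  positivity

theorem KFunctional_nonneg {t : ℝ} (ht : 0 ≤ t) (f : Lp ℝ 2 ν) :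
    0 ≤ KFunctional h.classes h.quotientNorm t f :=
  Real.iInf_nonneg fun y => by
    have := h.quotientNorm_nonneg y
    positivity

theorem KFunctional_monotoneOn (f : Lp ℝ 2 ν) :
    MonotoneOn (fun t => KFunctional h.classes h.quotientNorm t f) (Ioi 0) := by
  intro s hs t ht hst
  refine ciInf_mono (h.KFunctional_bddBelow (le_of_lt hs) f) fun y => ?_
  have := h.quotientNorm_nonneg y
  gcongr

/-- With `le_KFunctional`, this merges the infimum over classes and the infimum over representatives
into one infimum over `g ∈ H`. -/
theorem KFunctional_le {t : ℝ} (ht : 0 ≤ t) (f : Lp ℝ 2 ν) (g : H) :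
    KFunctional h.classes h.quotientNorm t f ≤ ‖f - h.embedding g‖ + t * ‖g‖ := by
  refine (ciInf_le (h.KFunctional_bddBelow ht f) ⟨h.embedding g, g, rfl⟩).trans ?_
  gcongr
  refine ciInf_le (f := fun g' : {g' : H // h.embedding g' = h.embedding g} => ‖(g' : H)‖) ?_
    ⟨g, rfl⟩
  exact ⟨0, by rintro _ ⟨g', rfl⟩; exact norm_nonneg _⟩

theorem le_KFunctional {t M : ℝ} (ht : 0 < t) {f : Lp ℝ 2 ν}
    (hM : ∀ g : H, M ≤ ‖f - h.embedding g‖ + t * ‖g‖) :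
    M ≤ KFunctional h.classes h.quotientNorm t f := by
  refine le_ciInf fun y => ?_
  obtain ⟨g₀, hg₀⟩ := y.2
  -- The real infimum over an empty fibre would default to 0.
  have : Nonempty {g : H // h.embedding g = (y : Lp ℝ 2 ν)} := ⟨⟨g₀, hg₀⟩⟩
  have h1 : (M - ‖f - (y : Lp ℝ 2 ν)‖) / t ≤ h.quotientNorm y := by
    refine le_ciInf fun ⟨g, hg⟩ => ?_
    rw [div_le_iff₀ ht]
    have := hM g
    rw [hg] at this
    simp only
    linarith
  rw [div_le_iff₀ ht] at h1
  linarith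

theorem interpolationNorm_eq (θ : ℝ) (r : ℝ≥0∞) (f : Lp ℝ 2 ν) :
    interpolationNorm h.classes h.quotientNorm θ r f =
      dilationNorm θ r fun t => KFunctional h.classes h.quotientNorm t f := rfl

variable {θ : ℝ} {r : ℝ≥0∞}

/-- Each sample is bounded by the whole norm, so `K(f, 2^{-k/2}) ≤ R 2^{-kθ/2} → 0`, while `K(f,t)`
dominates the distance of `f` to the range. -/
theorem mem_closure_range_of_mem_interpolationSpace (hθ₀ : 0 < θ) (hθ₁ : θ < 1) (hr : 1 ≤ r)
    {f : Lp ℝ 2 ν} (hf : f ∈ interpolationSpace h.classes h.quotientNorm θ r) :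
    f ∈ closure (range h.embedding) := by
  set Φ : ℝ → ℝ := fun t => KFunctional h.classes h.quotientNorm t f with hΦ
  have hΦ0 : ∀ t, 0 < t → 0 ≤ Φ t := fun t ht => h.KFunctional_nonneg ht.le f
  have hfin : 8 * dilationNorm θ r Φ < ∞ := ENNReal.mul_lt_top (by simp) hf
  set R := (8 * dilationNorm θ r Φ).toReal with hR
  have hbound : ∀ k : ℤ, Φ (halfScale k) ≤ R * halfScale k ^ θ := by
    intro k
    have hs := halfScale_pos k
    have h1 : dyadicSample θ Φ k ≤ 8 * dilationNorm θ r Φ :=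
      (le_lrNorm hr _ k).trans
        (lrNorm_dyadicSample_le hθ₀ hθ₁ (h.KFunctional_monotoneOn f) hΦ0 hr)
    have h2 : halfScale k ^ (-θ) * Φ (halfScale k) ≤ R :=
      (ENNReal.ofReal_le_iff_le_toReal hfin.ne).1 h1
    rwa [Real.rpow_neg hs.le, inv_mul_le_iff₀ (by positivity), mul_comm] at h2
  rw [Metric.mem_closure_range_iff]
  intro ε hε
  have hq : (2 : ℝ) ^ (-θ / 2) < 1 :=
    Real.rpow_lt_one_of_one_lt_of_neg (by norm_num) (by linarith)
  have hR0 : 0 ≤ R := ENNReal.toReal_nonneg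
  obtain ⟨n, hn⟩ := exists_pow_lt_of_lt_one (show 0 < ε / (R + 1) by positivity) hq
  have hpow : halfScale n ^ θ = ((2 : ℝ) ^ (-θ / 2)) ^ n := by
    rw [halfScale, ← Real.rpow_mul (by norm_num), ← Real.rpow_natCast,
      ← Real.rpow_mul (by norm_num)]
    congr 1
    push_cast; ring
  have hlt : Φ (halfScale n) < ε := by
    refine (hbound n).trans_lt ?_
    rw [hpow]
    rw [lt_div_iff₀ (by positivity)] at hn
    have : 0 ≤ ((2 : ℝ) ^ (-θ / 2)) ^ n := by positivity
    nlinarith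
  by_contra! hfar
  refine absurd hlt (not_lt.2 (h.le_KFunctional (halfScale_pos n) fun g => ?_))
  have h1 := hfar g
  have := halfScale_pos n
  rw [dist_eq_norm] at h1
  exact h1.trans (le_add_of_nonneg_right (by positivity))

end CompactlyEmbedded

/-! ### Eigensystems -/

namespace IsEigensystem

variable {X : Type*} [MeasurableSpace X] {ν : Measure X}
  {H : Type*} [NormedAddCommGroup H] [InnerProductSpace ℝ H] [CompleteSpace H] [RKHS ℝ H X ℝ]
  {h : CompactlyEmbedded H ν} {N : ℕ∞} {μ : IndexSet N → ℝ} {e : IndexSet N → H}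

/-- The real square root vanishes on non-positive numbers, which would contradict `‖√(μ i) • e i‖ =
1`. -/
theorem pos (hs : IsEigensystem h N μ e) (i : IndexSet N) : 0 < μ i := by
  by_contra hi
  have := hs.orthonormal.1 i
  simp [Real.sqrt_eq_zero'.2 (not_lt.1 hi)] at this

theorem adjoint_apply (hs : IsEigensystem h N μ e) (i : IndexSet N) :
    ContinuousLinearMap.adjoint h.embedding (h.embedding (e i)) = μ i • e i := by
  refine adjoint_apply_eq_smul hs.pos hs.orthonormal_classes hs.orthonormal (fun j => ?_) i
  have hmem : h.embedding (e j) ∈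
      Module.End.eigenspace (h.integralOperator : Lp ℝ 2 ν →ₗ[ℝ] Lp ℝ 2 ν) (μ j) := by
    rw [← hs.span_eq (μ j) (hs.ne_zero j)]
    exact Submodule.subset_span ⟨j, rfl, rfl⟩
  exact Module.End.mem_eigenspace_iff.1 hmem

variable {θ : ℝ} {r : ℝ≥0∞}

/-- Valid for every `f`, since the lower bound of the K-functional rests on Bessel and needs no
expansion of `f`. The 16 is 2 (blocks) times 8 (sampling). -/
theorem sequenceNorm_le_interpolationNorm (hs : IsEigensystem h N μ e) (hθ₀ : 0 < θ) (hθ₁ : θ < 1)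
    (hr : 1 ≤ r) (f : Lp ℝ 2 ν) :
    sequenceNorm μ θ r (fun i => ⟪h.embedding (e i), f⟫_ℝ) ≤
      16 * interpolationNorm h.classes h.quotientNorm θ r f := by
  set b : IndexSet N → ℝ := fun i => ⟪h.embedding (e i), f⟫_ℝ with hb
  set Φ : ℝ → ℝ := fun t => KFunctional h.classes h.quotientNorm t f with hΦ
  have hlow : ∀ t, 0 < t → truncNorm μ b t ≤ ENNReal.ofReal (Φ t) := by
    intro t ht
    have h1 := fun g => truncNorm_le hs.pos hs.orthonormal_classes hs.orthonormal
      hs.adjoint_apply ht f g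
    -- The choice `g = 0` shows finiteness.
    have hne : truncNorm μ b t ≠ ∞ := ((h1 0).trans_lt ENNReal.ofReal_lt_top).ne
    rw [ENNReal.le_ofReal_iff_toReal_le hne (h.KFunctional_nonneg ht.le f)]
    refine h.le_KFunctional ht fun g => ?_
    exact (ENNReal.le_ofReal_iff_toReal_le hne (by positivity)).1 (h1 g)
  calc sequenceNorm μ θ r b
      ≤ 2 * lrNorm r (fun k => ENNReal.ofReal (halfScale k ^ (-θ)) *
          truncNorm μ b (halfScale k)) := sequenceNorm_le_lrNorm_truncNorm hs.pos hθ₀ hθ₁ hr b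
    _ ≤ 2 * lrNorm r (dyadicSample θ Φ) := by
        gcongr
        refine lrNorm_mono fun k => ?_
        have := halfScale_pos k
        rw [dyadicSample, ENNReal.ofReal_mul (by positivity)]
        gcongr
        exact hlow _ this
    _ ≤ 2 * (8 * dilationNorm θ r Φ) := by
        gcongr
        exact lrNorm_dyadicSample_le hθ₀ hθ₁ (h.KFunctional_monotoneOn f)
          (fun t ht => h.KFunctional_nonneg ht.le f) hr
    _ = _ := by
        rw [← mul_assoc, h.interpolationNorm_eq, show (2 : ℝ≥0∞) * 8 = 16 by norm_num]

/-- The 8 collects three factors 2: sampling, the choice of `g`, and the splitting into blocks. -/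
theorem interpolationNorm_le_sequenceNorm (hs : IsEigensystem h N μ e) (hθ₀ : 0 < θ) (hθ₁ : θ < 1)
    (hr : 1 ≤ r) {f : Lp ℝ 2 ν} {b : IndexSet N → ℝ}
    (hb : HasSum (fun i => b i • h.embedding (e i)) f) :
    interpolationNorm h.classes h.quotientNorm θ r f ≤
      (8 * ∑' n, blockWeight θ n) * sequenceNorm μ θ r b := by
  set Φ : ℝ → ℝ := fun t => KFunctional h.classes h.quotientNorm t f with hΦ
  have hup : ∀ t, 0 < t → ENNReal.ofReal (Φ t) ≤ 2 * truncNorm μ b t := by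
    intro t ht
    obtain ⟨g, hg⟩ := exists_le_truncNorm hs.pos hs.orthonormal_classes hs.orthonormal hb ht
    exact (ENNReal.ofReal_le_ofReal (h.KFunctional_le ht.le f g)).trans hg
  calc interpolationNorm h.classes h.quotientNorm θ r f
      ≤ 2 * lrNorm r (dyadicSample θ Φ) :=
        dilationNorm_le hθ₀ hθ₁ (h.KFunctional_monotoneOn f)
          (fun t ht => h.KFunctional_nonneg ht.le f) hr
    _ ≤ 2 * lrNorm r (fun k => 2 * (ENNReal.ofReal (halfScale k ^ (-θ)) *
          truncNorm μ b (halfScale k))) := by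
        gcongr
        refine lrNorm_mono fun k => ?_
        have := halfScale_pos k
        rw [dyadicSample, ENNReal.ofReal_mul (by positivity), mul_left_comm]
        gcongr
        exact hup _ this
    _ ≤ 2 * (2 * (2 * ((∑' n, blockWeight θ n) * sequenceNorm μ θ r b))) := by
        rw [lrNorm_const_mul hr]
        gcongr
        exact lrNorm_truncNorm_le hs.pos hθ₀ hθ₁ hr b
    _ = _ := by ring

theorem hasSum_of_mem_interpolationSpace (hs : IsEigensystem h N μ e) (hθ₀ : 0 < θ) (hθ₁ : θ < 1)
    (hr : 1 ≤ r) {f : Lp ℝ 2 ν} (hf : f ∈ interpolationSpace h.classes h.quotientNorm θ r) :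
    HasSum (fun i => ⟪h.embedding (e i), f⟫_ℝ • h.embedding (e i)) f := by
  refine hs.orthonormal_classes.hasSum_of_mem_closure
    (closure_range_subset_closure_span h.isCompactOperator_embedding (fun c hc => ?_)
      (h.mem_closure_range_of_mem_interpolationSpace hθ₀ hθ₁ hr hf))
  exact (hs.span_eq c hc).symm.le.trans (Submodule.span_mono (image_subset_range _ _))

end IsEigensystem

end

theorem theorem1 {X : Type*} [MeasurableSpace X] (ν : Measure X)
    {H : Type*} [NormedAddCommGroup H] [InnerProductSpace ℝ H] [CompleteSpace H] [RKHS ℝ H X ℝ]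
    (hk : Measurable (scalarKernel H)) (h : CompactlyEmbedded H ν)
    (θ : ℝ) (hθ₀ : 0 < θ) (hθ₁ : θ < 1) (r : ℝ≥0∞) (hr : 1 ≤ r) :
    (∃ (N : ℕ∞) (μ : IndexSet N → ℝ) (e : IndexSet N → H), IsEigensystem h N μ e) ∧
    ∀ (N : ℕ∞) (μ : IndexSet N → ℝ) (e : IndexSet N → H), IsEigensystem h N μ e →
      powerSpace μ (fun i => h.embedding (e i)) θ r =
        interpolationSpace h.classes h.quotientNorm θ r ∧
      ∃ c C : ℝ, 0 < c ∧ 0 < C ∧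
        ∀ f ∈ powerSpace μ (fun i => h.embedding (e i)) θ r,
          ENNReal.ofReal c * powerNorm μ (fun i => h.embedding (e i)) θ r f ≤
            interpolationNorm h.classes h.quotientNorm θ r f ∧
          interpolationNorm h.classes h.quotientNorm θ r f ≤
            ENNReal.ofReal C * powerNorm μ (fun i => h.embedding (e i)) θ r f := by
  refine ⟨?_, fun N μ e hs => ?_⟩
  · obtain ⟨N, μ, e, h1, h2, h3, h4, h5⟩ := exists_singularSystem h.isCompactOperator_embedding
    exact ⟨N, μ, e, h1, h2, h3, h4, h5⟩
  have hW : 8 * ∑' n, blockWeight θ n < ∞ :=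
    ENNReal.mul_lt_top (by simp) (tsum_blockWeight_lt_top hθ₀ hθ₁)
  -- The `+ 1` makes the constant positive without a lower bound on the sum.
  refine ⟨?_, 1 / 16, (8 * ∑' n, blockWeight θ n).toReal + 1, by norm_num,
    by have := ENNReal.toReal_nonneg (a := 8 * ∑' n, blockWeight θ n); linarith, ?_⟩
  · ext f
    constructor
    · rintro ⟨b, hb, hf⟩
      exact (hs.interpolationNorm_le_sequenceNorm hθ₀ hθ₁ hr hf).trans_lt
        (ENNReal.mul_lt_top hW hb)
    · intro hf
      exact ⟨_, (hs.sequenceNorm_le_interpolationNorm hθ₀ hθ₁ hr f).trans_lt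
        (ENNReal.mul_lt_top (by simp) hf), hs.hasSum_of_mem_interpolationSpace hθ₀ hθ₁ hr hf⟩
  · rintro f ⟨b, -, hf⟩
    rw [powerNorm_eq μ hs.orthonormal_classes θ r hf]
    constructor
    · have hb : (fun i => ⟪h.embedding (e i), f⟫_ℝ) = b :=
        funext fun i => hs.orthonormal_classes.inner_eq_of_hasSum hf i
      have h1 := hs.sequenceNorm_le_interpolationNorm hθ₀ hθ₁ hr f
      rw [hb] at h1
      calc ENNReal.ofReal (1 / 16) * sequenceNorm μ θ r b
          ≤ ENNReal.ofReal (1 / 16) *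
            (16 * interpolationNorm h.classes h.quotientNorm θ r f) := by gcongr
        _ = _ := by
            rw [← mul_assoc, show (16 : ℝ≥0∞) = ENNReal.ofReal 16 by norm_num,
              ← ENNReal.ofReal_mul (by norm_num)]
            norm_num
    · refine (hs.interpolationNorm_le_sequenceNorm hθ₀ hθ₁ hr hf).trans ?_
      gcongr
      rw [ENNReal.le_ofReal_iff_toReal_le hW.ne (by positivity)]
      linarith
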